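/- Let $h\in\mathbb C$ be such that $q=e^h$ is not a root of unity; put $q^x=e^{hx}$, $[x]=\frac{q^x-q^{-x}}{q-q^{-1}}$, and define $[H]$ for an endomorphism $H$ of a finite-dimensional complex space by the same formula with $q^{H}=\exp(hH)$. A (finite-dimensional) representation of $U_q[gl(2/1)]$ is a finite-dimensional complex vector space with operators $E_{11},E_{22},E_{33},E_{12},E_{21},E_{23},E_{32}$ such that, with $H_1=E_{11}-E_{22}$, $H_2=E_{22}+E_{33}$, $[A,B]_r=AB-rBA$, $E_{13}=[E_{12},E_{23}]_{q^{-1}}$, $E_{31}=-[E_{21},E_{32}]_{q^{-1}}$, $$[E_{ii},E_{jj}]=0,\quad [E_{ii},E_{j,j+1}]=(\delta_{ij}-\delta_{i,j+1})E_{j,j+1},\quad [E_{ii},E_{j+1,j}]=(\delta_{i,j+1}-\delta_{ij})E_{j+1,j},$$ $$[E_{12},E_{21}]=[H_1],\quad \{E_{23},E_{32}\}=[H_2],\quad [E_{12},E_{32}]=[E_{23},E_{21}]=0,$$ $$E_{23}^2=E_{32}^2=0,\quad [E_{12},E_{13}]_q=[E_{21},E_{31}]_q=0 .$$ It is called regular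 if, for every eigenvalue $c$ of $H_1$ and every $k\in\mathbb Z$, $[c-k]=0$ implies $c=k$. A signature is a triple $[m]=[m_{13},m_{23},m_{33}]$ of complex numbers with $n:=m_{13}-m_{23}\in\mathbb Z_{\ge 0}$. Put $2l=n$, $l_{1j}=m_{1j}-1$, $l_{2j}=m_{2j}-2$, $l_{33}=m_{33}-1$, $\xi=[l_{23}+l_{33}+3]=[m_{23}+m_{33}]$, $\eta=[l_{13}+l_{33}+3]=[m_{13}+m_{33}+1]$, and fix nonzero constants $a_1,a_2,a_3\in\mathbb C$. The module $W^q([m])$ has a basis of vectors $(m)_k$, $k=0,1,2,3$, where $m_{11}$ runs through the numbers with $m_{12}-m_{11},\,m_{11}-m_{22}\in\mathbb Z_{\ge0}$, and $(m_{12},m_{22},m_{32})$ equals $(m_{13},m_{23},m_{33})$, $(m_{13},m_{23}-1,m_{33}+1)$, $(m_{13}-1,m_{23},m_{33}+1)$, $(m_{13}-1,m_{23}-1,m_{33}+2)$ for $k=0,1,2,3$, respectively; $V^q_k$ is the span of the $(m)_k$ and $V^q([m])=V^q_0$. Let $(m)_k^{\pm11}$ be $(m)_k$ with $m_{11}$ replaced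 by $m_{11}\pm1$, let $[x]^{1/2}$ be a fixed square root of each $[x]$, and take the square root of a product or quotient of $q$-numbers factor by factor; vectors $(m)_k$ that do not exist are read as $0$. The generators act by $$E_{11}(m)_k=m_{11}(m)_k,\quad E_{22}(m)_k=(m_{12}+m_{22}-m_{11})(m)_k,\quad E_{33}(m)_k=m_{32}(m)_k,$$ $$E_{12}(m)_k=([l_{12}-l_{11}][l_{11}-l_{22}])^{1/2}(m)_k^{+11},\quad E_{21}(m)_k=([l_{12}-l_{11}+1][l_{11}-l_{22}-1])^{1/2}(m)_k^{-11},$$ $$E_{23}(m)_0=0,\quad E_{23}(m)_1=a_1\Big(\tfrac{[l_{11}-l_{23}]}{[2l+1]}\Big)^{1/2}\xi\,(m)_0,\quad E_{23}(m)_2=a_2\Big(\tfrac{[l_{13}-l_{11}]}{[2l]}\Big)^{1/2}\eta\,(m)_0,$$ $$E_{23}(m)_3=a_3\Big\{\tfrac1{a_1q}\Big(\tfrac{[l_{13}-l_{11}]}{[2l+1]}\Big)^{1/2}\eta\,(m)_1-\tfrac1{a_2q}\big([l_{11}-l_{23}][2l]\big)^{1/2}\tfrac{\xi}{[2l+1]}(m)_2\Big\},$$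 $$E_{32}(m)_0=\tfrac1{a_1}\Big(\tfrac{[l_{11}-l_{23}]}{[2l+1]}\Big)^{1/2}(m)_1+\tfrac1{a_2}\tfrac{([l_{13}-l_{11}][2l])^{1/2}}{[2l+1]}(m)_2,$$ $$E_{32}(m)_1=\tfrac{a_1q}{a_3}\Big(\tfrac{[l_{13}-l_{11}]}{[2l+1]}\Big)^{1/2}(m)_3,\quad E_{32}(m)_2=-\tfrac{a_2q}{a_3}\Big(\tfrac{[l_{11}-l_{23}]}{[2l]}\Big)^{1/2}(m)_3,\quad E_{32}(m)_3=0 .$$ Proposition 8. Each $W^q([m])$ is a representation of $U_q[gl(2/1)]$, and is the module induced from the $U_q[gl(2)\oplus gl(1)]$-module $V^q([m])$ with $E_{23}V^q([m])=0$: every linear map from $V^q([m])$ to a representation that commutes with $E_{11},E_{22},E_{33},E_{12},E_{21}$ and has its image annihilated by $E_{23}$ extends to exactly one homomorphism from $W^q([m])$. The modules constructed in this way, and their quotients below, cover all regular finite-dimensional irreducible representations of $U_q[gl(2/1)]$. More precisely, a finite-dimensional complex vector space with seven operators $E_{ij}$ is a regular irreducible representation of $U_q[gl(2/1)]$ if and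 only if, for some signature $[m]$, one of the following holds: (typical) $\xi\eta\neq0$ and it is isomorphic to $W^q([m])$; (nontypical, class 1) $\eta=0$, $\xi\neq0$, the subspace $I^q_1=V^q_3\oplus V^q_2$ of $W^q([m])$ is invariant, and it is isomorphic to $W^q([m])/I^q_1$; (nontypical, class 2) $\eta\neq0$, $\xi=0$, the subspace $I^q_2=V^q_3\oplus V^q_1$ of $W^q([m])$ is invariant, and it is isomorphic to $W^q([m])/I^q_2$. -/

import Mathlib

universe u

namespace UqGL21

/-! ### `q`-numbers, with `q = exp h` and `q ^ x = exp (h * x)` -/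

/-- The `q`-number `[x] = (q ^ x - q ^ (-x)) / (q - q⁻¹)`, where `q = exp h`. -/
noncomputable def qn (h x : ℂ) : ℂ :=
  (Complex.exp (h * x) - Complex.exp (-(h * x))) / (Complex.exp h - Complex.exp (-h))

/-- The square root `[x] ^ (1/2)` of a `q`-number. -/
noncomputable def rt (h x : ℂ) : ℂ := qn h x ^ (1 / 2 : ℂ)

/-- `q = exp h` is not a root of unity. -/
def Generic (h : ℂ) : Prop := ∀ n : ℕ, n ≠ 0 → Complex.exp h ^ n ≠ 1

section Operators

variable {V : Type*} [AddCommGroup V] [Module ℂ V]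

/-- The exponential of an endomorphism of a finite-dimensional complex vector space. -/
noncomputable def expEnd [FiniteDimensional ℂ V] (A : Module.End ℂ V) : Module.End ℂ V :=
  (LinearMap.toMatrixAlgEquiv (Module.finBasis ℂ V)).symm
    (NormedSpace.exp (LinearMap.toMatrixAlgEquiv (Module.finBasis ℂ V) A))

/-- The operator `[H] = (q ^ H - q ^ (-H)) / (q - q⁻¹)`, where `q ^ H = exp (h H)`. -/
noncomputable def qnOp [FiniteDimensional ℂ V] (h : ℂ) (H : Module.End ℂ V) : Module.End ℂ V :=
  (Complex.exp h - Complex.exp (-h))⁻¹ • (expEnd (h • H) - expEnd (-(h • H)))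

/-- The deformed commutator `[A, B]_r = A B - r B A`. -/
def brk (r : ℂ) (A B : Module.End ℂ V) : Module.End ℂ V := A * B - r • (B * A)

end Operators

/-! ### Representations of `U_q[gl(2/1)]` -/

/-- Operators standing for the generators of the even subalgebra `U_q[gl(2) ⊕ gl(1)]`. -/
structure EvenOps (V : Type*) [AddCommGroup V] [Module ℂ V] where
  E11 : Module.End ℂ V
  E22 : Module.End ℂ V
  E33 : Module.End ℂ V
  E12 : Module.End ℂ V
  E21 : Module.End ℂ V

/-- Operators standing for the Weyl--Chevalley generators of `U_q[gl(2/1)]`. -/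
structure Ops (V : Type*) [AddCommGroup V] [Module ℂ V] extends EvenOps V where
  E23 : Module.End ℂ V
  E32 : Module.End ℂ V

namespace Ops

variable {V : Type*} [AddCommGroup V] [Module ℂ V]

/-- `H₁ = E₁₁ - (d₂/d₁) E₂₂ = E₁₁ - E₂₂`. -/
def H1 (ρ : Ops V) : Module.End ℂ V := ρ.E11 - ρ.E22

/-- `H₂ = E₂₂ - (d₃/d₂) E₃₃ = E₂₂ + E₃₃`. -/
def H2 (ρ : Ops V) : Module.End ℂ V := ρ.E22 + ρ.E33

/-- `E₁₃ = [E₁₂, E₂₃]_{q⁻¹}`. -/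
noncomputable def E13 (h : ℂ) (ρ : Ops V) : Module.End ℂ V :=
  brk (Complex.exp h)⁻¹ ρ.E12 ρ.E23

/-- `E₃₁ = -[E₂₁, E₃₂]_{q⁻¹}`. -/
noncomputable def E31 (h : ℂ) (ρ : Ops V) : Module.End ℂ V :=
  -brk (Complex.exp h)⁻¹ ρ.E21 ρ.E32

/-- The operators satisfy the defining relations of `U_q[gl(2/1)]`, `q = exp h`. -/
structure IsRep [FiniteDimensional ℂ V] (h : ℂ) (ρ : Ops V) : Prop where
  cartan12 : brk 1 ρ.E11 ρ.E22 = 0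
  cartan13 : brk 1 ρ.E11 ρ.E33 = 0
  cartan23 : brk 1 ρ.E22 ρ.E33 = 0
  wt11_12 : brk 1 ρ.E11 ρ.E12 = ρ.E12
  wt22_12 : brk 1 ρ.E22 ρ.E12 = -ρ.E12
  wt33_12 : brk 1 ρ.E33 ρ.E12 = 0
  wt11_23 : brk 1 ρ.E11 ρ.E23 = 0
  wt22_23 : brk 1 ρ.E22 ρ.E23 = ρ.E23
  wt33_23 : brk 1 ρ.E33 ρ.E23 = -ρ.E23
  wt11_21 : brk 1 ρ.E11 ρ.E21 = -ρ.E21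
  wt22_21 : brk 1 ρ.E22 ρ.E21 = ρ.E21
  wt33_21 : brk 1 ρ.E33 ρ.E21 = 0
  wt11_32 : brk 1 ρ.E11 ρ.E32 = 0
  wt22_32 : brk 1 ρ.E22 ρ.E32 = -ρ.E32
  wt33_32 : brk 1 ρ.E33 ρ.E32 = ρ.E32
  comm12_21 : brk 1 ρ.E12 ρ.E21 = qnOp h ρ.H1
  anticomm23_32 : brk (-1) ρ.E23 ρ.E32 = qnOp h ρ.H2
  comm12_32 : brk 1 ρ.E12 ρ.E32 = 0
  comm23_21 : brk 1 ρ.E23 ρ.E21 = 0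
  sq23 : ρ.E23 * ρ.E23 = 0
  sq32 : ρ.E32 * ρ.E32 = 0
  serre12 : brk (Complex.exp h) ρ.E12 (ρ.E13 h) = 0
  serre21 : brk (Complex.exp h) ρ.E21 (ρ.E31 h) = 0

/-- A subspace stable under all generators. -/
structure Invariant (ρ : Ops V) (N : Submodule ℂ V) : Prop where
  E11 : N ≤ N.comap ρ.E11
  E22 : N ≤ N.comap ρ.E22
  E33 : N ≤ N.comap ρ.E33
  E12 : N ≤ N.comap ρ.E12
  E21 : N ≤ N.comap ρ.E21
  E23 : N ≤ N.comap ρ.E23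
  E32 : N ≤ N.comap ρ.E32

/-- Irreducibility: the space is nonzero and has no proper nonzero invariant subspace. -/
def Irreducible (ρ : Ops V) : Prop :=
  Nontrivial V ∧ ∀ N : Submodule ℂ V, ρ.Invariant N → N = ⊥ ∨ N = ⊤

/-- The convention that `[x] = 0` means `x = 0`, for those `x` that differ by an integer from
an eigenvalue of `H₁`. (It excludes twists by characters such as `E₁₁ ↦ π i / h`, with
`E₁₂, E₂₁, E₂₂, E₃₃, E₂₃, E₃₂ ↦ 0`, on which `q ^ H₁ = -1`.) -/
def RegularWeights (h : ℂ) (ρ : Ops V) : Prop :=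
  ∀ c : ℂ, Module.End.HasEigenvalue ρ.H1 c → ∀ k : ℤ, qn h (c - k) = 0 → c - k = 0

/-- The operators on a quotient by an invariant subspace. -/
def quot (ρ : Ops V) (N : Submodule ℂ V) (hN : ρ.Invariant N) : Ops (V ⧸ N) where
  E11 := N.mapQ N ρ.E11 hN.E11
  E22 := N.mapQ N ρ.E22 hN.E22
  E33 := N.mapQ N ρ.E33 hN.E33
  E12 := N.mapQ N ρ.E12 hN.E12
  E21 := N.mapQ N ρ.E21 hN.E21
  E23 := N.mapQ N ρ.E23 hN.E23
  E32 := N.mapQ N ρ.E32 hN.E32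

end Ops

/-- A linear map commuting with the even generators. -/
structure EvenIntertwines {V W : Type*} [AddCommGroup V] [Module ℂ V] [AddCommGroup W] [Module ℂ W]
    (ρ : EvenOps V) (σ : EvenOps W) (f : V →ₗ[ℂ] W) : Prop where
  E11 : ∀ v, f (ρ.E11 v) = σ.E11 (f v)
  E22 : ∀ v, f (ρ.E22 v) = σ.E22 (f v)
  E33 : ∀ v, f (ρ.E33 v) = σ.E33 (f v)
  E12 : ∀ v, f (ρ.E12 v) = σ.E12 (f v)
  E21 : ∀ v, f (ρ.E21 v) = σ.E21 (f v)

/-- A linear map commuting with all generators. -/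
structure Intertwines {V W : Type*} [AddCommGroup V] [Module ℂ V] [AddCommGroup W] [Module ℂ W]
    (ρ : Ops V) (σ : Ops W) (f : V →ₗ[ℂ] W) : Prop
    extends EvenIntertwines ρ.toEvenOps σ.toEvenOps f where
  E23 : ∀ v, f (ρ.E23 v) = σ.E23 (f v)
  E32 : ∀ v, f (ρ.E32 v) = σ.E32 (f v)

/-- Isomorphism of representations. -/
def Iso {V W : Type*} [AddCommGroup V] [Module ℂ V] [AddCommGroup W] [Module ℂ W]
    (ρ : Ops V) (σ : Ops W) : Prop :=
  ∃ e : V ≃ₗ[ℂ] W, Intertwines ρ σ e.toLinearMap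

/-- `W` (with operators `σ`), together with `j : V₀ → W`, is the module induced from the
`U_q[gl(2) ⊕ gl(1)]`-module `V₀` on which `E₂₃` is set to act by zero: `j` is an even map with
`E₂₃ (j V₀) = 0`, and each even map `f` from `V₀` to a finite-dimensional representation with
`E₂₃ (f V₀) = 0` factors through `j` by exactly one homomorphism of representations. -/
def IsInduced {V₀ W : Type*} [AddCommGroup V₀] [Module ℂ V₀] [AddCommGroup W] [Module ℂ W]
    (h : ℂ) (ρ₀ : EvenOps V₀) (σ : Ops W) (j : V₀ →ₗ[ℂ] W) : Prop :=
  EvenIntertwines ρ₀ σ.toEvenOps j ∧ (∀ v, σ.E23 (j v) = 0) ∧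
  ∀ (V : Type u) [AddCommGroup V] [Module ℂ V] [FiniteDimensional ℂ V] (ρ : Ops V),
    ρ.IsRep h → ∀ f : V₀ →ₗ[ℂ] V, EvenIntertwines ρ₀ ρ.toEvenOps f → (∀ v, ρ.E23 (f v) = 0) →
      ∃! g : W →ₗ[ℂ] V, Intertwines σ ρ g ∧ g ∘ₗ j = f

/-! ### The modules `V^q([m])` and `W^q([m])` -/

/-- A signature `[m] = [m₁₃, m₂₃, m₃₃]`: complex numbers with `m₁₃ - m₂₃ = n ∈ ℤ₊`. -/
structure Signature where
  m13 : ℂ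
  m23 : ℂ
  m33 : ℂ
  n : ℕ
  sub_eq : m13 - m23 = n

/-- Matrix element of `E₁₂` on the Gelfand--Zetlin vector with entries `m₁₂, m₂₂, m₁₁`:
`([l₁₂ - l₁₁] [l₁₁ - l₂₂]) ^ (1/2)`, where `l₁ⱼ = m₁ⱼ - 1`, `l₂ⱼ = m₂ⱼ - 2`. -/
noncomputable def c12 (h m12 m22 m11 : ℂ) : ℂ :=
  rt h ((m12 - 1) - (m11 - 1)) * rt h ((m11 - 1) - (m22 - 2))

/-- Matrix element of `E₂₁` on the Gelfand--Zetlin vector with entries `m₁₂, m₂₂, m₁₁`: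
`([l₁₂ - l₁₁ + 1] [l₁₁ - l₂₂ - 1]) ^ (1/2)`. -/
noncomputable def c21 (h m12 m22 m11 : ℂ) : ℂ :=
  rt h ((m12 - 1) - (m11 - 1) + 1) * rt h ((m11 - 1) - (m22 - 2) - 1)

/-- `m₁₃ - m₁₂` for the patterns of `V_k^q`. -/
def top : Fin 4 → ℕ := ![0, 0, 1, 1]

/-- `m₂₃ - m₂₂` for the patterns of `V_k^q`. -/
def bot : Fin 4 → ℕ := ![0, 1, 0, 1]

/-- Labels `(k, i)` of the basis vectors `(m)_k` of `W^q([m])`, where `i = m₁₃ - m₁₁`; the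
condition says `m₁₂ - m₁₁ ∈ ℤ₊` and `m₁₁ - m₂₂ ∈ ℤ₊`. -/
abbrev Label (n : ℕ) : Type :=
  {p : Fin 4 × Fin (n + 2) // top p.1 ≤ (p.2 : ℕ) ∧ (p.2 : ℕ) ≤ n + bot p.1}

namespace Signature

variable (S : Signature)

/-- `l₁₃ = m₁₃ - 1`. -/
noncomputable def l13 : ℂ := S.m13 - 1
/-- `l₂₃ = m₂₃ - 2`. -/
noncomputable def l23 : ℂ := S.m23 - 2
/-- `l₃₃ = m₃₃ - 1`. -/
noncomputable def l33 : ℂ := S.m33 - 1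
/-- `m₁₁ = m₁₃ - i`. -/
noncomputable def m11 (i : ℕ) : ℂ := S.m13 - i
/-- `l₁₁ = m₁₁ - 1`. -/
noncomputable def l11 (i : ℕ) : ℂ := S.m11 i - 1
/-- `2l = m₁₃ - m₂₃`. -/
noncomputable def twol : ℂ := S.m13 - S.m23
/-- The entry `m₁₂` of the patterns of `V_k^q`. -/
noncomputable def m12 (k : Fin 4) : ℂ := S.m13 - top k
/-- The entry `m₂₂` of the patterns of `V_k^q`. -/
noncomputable def m22 (k : Fin 4) : ℂ := S.m23 - bot k
/-- The entry `m₃₂ = m₃₁` of the patterns of `V_k^q`. -/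
noncomputable def m32 (k : Fin 4) : ℂ := S.m33 + top k + bot k

/-- The space of `V^q([m])`, with a basis of vectors `(m)` labelled by
`i = m₁₃ - m₁₁ ∈ {0, …, n}`. -/
abbrev VSpace : Type := Fin (S.n + 1) → ℂ

/-- The basis vector of `V^q([m])` with label `i`, and zero if there is no such label. -/
def vvec (i : ℕ) : S.VSpace := fun p => if (p : ℕ) = i then 1 else 0

/-- The linear map with given values on the basis vectors of `V^q([m])`. -/
noncomputable def vOp {X : Type*} [AddCommGroup X] [Module ℂ X] (F : ℕ → X) : S.VSpace →ₗ[ℂ] X :=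
  (Pi.basisFun ℂ (Fin (S.n + 1))).constr ℂ fun p => F p

/-- The irreducible `U_q[gl(2) ⊕ gl(1)]`-module `V^q([m])` in its Gelfand--Zetlin basis. The
truncated `i - 1` is harmless: at `i = 0` the coefficient contains `[0] = 0`. -/
noncomputable def Vq (h : ℂ) : EvenOps S.VSpace where
  E11 := S.vOp fun i => S.m11 i • S.vvec i
  E22 := S.vOp fun i => (S.m13 + S.m23 - S.m11 i) • S.vvec i
  E33 := S.vOp fun i => S.m33 • S.vvec i
  E12 := S.vOp fun i => c12 h S.m13 S.m23 (S.m11 i) • S.vvec (i - 1)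
  E21 := S.vOp fun i => c21 h S.m13 S.m23 (S.m11 i) • S.vvec (i + 1)

/-- The space of `W^q([m])`. -/
abbrev WSpace : Type := Label S.n → ℂ

/-- The basis vector `(m)_k` with `m₁₁ = m₁₃ - i`, and zero if there is no such pattern. -/
def wvec (k : Fin 4) (i : ℕ) : S.WSpace :=
  fun p => if p.1.1 = k ∧ (p.1.2 : ℕ) = i then 1 else 0

/-- The linear map on `W^q([m])` with given values on the basis vectors `(m)_k`. -/
noncomputable def wOp (F : Fin 4 → ℕ → S.WSpace) : Module.End ℂ S.WSpace :=
  (Pi.basisFun ℂ (Label S.n)).constr ℂ fun p => F p.1.1 p.1.2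

/-- The action of `E₂₃` on the basis vectors of `W^q([m])`. -/
noncomputable def w23 (h a₁ a₂ a₃ : ℂ) (k : Fin 4) (i : ℕ) : S.WSpace :=
  match k with
  | 0 => 0
  | 1 => (a₁ * (rt h (S.l11 i - S.l23) / rt h (S.twol + 1)) *
      qn h (S.l23 + S.l33 + 3)) • S.wvec 0 i
  | 2 => (a₂ * (rt h (S.l13 - S.l11 i) / rt h S.twol) *
      qn h (S.l13 + S.l33 + 3)) • S.wvec 0 i
  | 3 => a₃ • ((1 / (a₁ * Complex.exp h) * (rt h (S.l13 - S.l11 i) / rt h (S.twol + 1)) *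
        qn h (S.l13 + S.l33 + 3)) • S.wvec 1 i -
      (1 / (a₂ * Complex.exp h) * (rt h (S.l11 i - S.l23) * rt h S.twol) *
        (qn h (S.l23 + S.l33 + 3) / qn h (S.twol + 1))) • S.wvec 2 i)

/-- The action of `E₃₂` on the basis vectors of `W^q([m])`. -/
noncomputable def w32 (h a₁ a₂ a₃ : ℂ) (k : Fin 4) (i : ℕ) : S.WSpace :=
  match k with
  | 0 => (1 / a₁ * (rt h (S.l11 i - S.l23) / rt h (S.twol + 1))) • S.wvec 1 i +
      (1 / a₂ * (rt h (S.l13 - S.l11 i) * rt h S.twol / qn h (S.twol + 1))) • S.wvec 2 i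
  | 1 => (a₁ * Complex.exp h / a₃ * (rt h (S.l13 - S.l11 i) / rt h (S.twol + 1))) • S.wvec 3 i
  | 2 => -(a₂ * Complex.exp h / a₃ * (rt h (S.l11 i - S.l23) / rt h S.twol)) • S.wvec 3 i
  | 3 => 0

/-- The representation `W^q([m])` in the reduced basis `(m), (m)₁, (m)₂, (m)₃`, with
normalization constants `a₁, a₂, a₃`. The even generators act on each `V_k^q` by the
Gelfand--Zetlin formulas. -/
noncomputable def Wq (h a₁ a₂ a₃ : ℂ) : Ops S.WSpace where
  E11 := S.wOp fun k i => S.m11 i • S.wvec k i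
  E22 := S.wOp fun k i => (S.m12 k + S.m22 k - S.m11 i) • S.wvec k i
  E33 := S.wOp fun k i => S.m32 k • S.wvec k i
  E12 := S.wOp fun k i => c12 h (S.m12 k) (S.m22 k) (S.m11 i) • S.wvec k (i - 1)
  E21 := S.wOp fun k i => c21 h (S.m12 k) (S.m22 k) (S.m11 i) • S.wvec k (i + 1)
  E23 := S.wOp (S.w23 h a₁ a₂ a₃)
  E32 := S.wOp (S.w32 h a₁ a₂ a₃)

/-- The identification of `V^q([m])` with `V_0^q ⊆ W^q([m])`. -/
noncomputable def incl : S.VSpace →ₗ[ℂ] S.WSpace := S.vOp fun i => S.wvec 0 i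

/-- The subspace `V_k^q` of `W^q([m])`. -/
def Vk (k : Fin 4) : Submodule ℂ S.WSpace := Submodule.span ℂ (Set.range (S.wvec k))

/-- `I_1^q = V_3^q ⊕ V_2^q`. -/
def I1 : Submodule ℂ S.WSpace := S.Vk 3 ⊔ S.Vk 2

/-- `I_2^q = V_3^q ⊕ V_1^q`. -/
def I2 : Submodule ℂ S.WSpace := S.Vk 3 ⊔ S.Vk 1

/-- `[l₁₃ + l₃₃ + 3] [l₂₃ + l₃₃ + 3] ≠ 0`. -/
def Typical (h : ℂ) : Prop := qn h (S.l13 + S.l33 + 3) * qn h (S.l23 + S.l33 + 3) ≠ 0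

/-- `[l₁₃ + l₃₃ + 3] = 0` and `[l₂₃ + l₃₃ + 3] ≠ 0`. -/
def Class1 (h : ℂ) : Prop := qn h (S.l13 + S.l33 + 3) = 0 ∧ qn h (S.l23 + S.l33 + 3) ≠ 0

/-- `[l₁₃ + l₃₃ + 3] ≠ 0` and `[l₂₃ + l₃₃ + 3] = 0`. -/
def Class2 (h : ℂ) : Prop := qn h (S.l13 + S.l33 + 3) ≠ 0 ∧ qn h (S.l23 + S.l33 + 3) = 0

end Signature

end UqGL21

/-! In terms of `[i] ^ (1/2)` and `[n + 1 - i] ^ (1/2)`, with `i = m₁₃ - m₁₁`, the defining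
relations on the vectors `(m)_k` reduce to three `q`-number identities: an addition formula for
`[E₁₂, E₂₁]`, an interpolation between `ξ` and `η` for `{E₂₃, E₃₂}`, and a three-term recursion for
the Serre relations.

Induction needs no PBW basis. If `X` is stable under the even generators and killed by `E₂₃`, then
`X + E₃₂ X + E₃₁ X + E₃₂ E₃₁ X` is invariant (`Primitive.invariant_generated`) and has dimension at
most `4 dim X`. For an even map `f : V^q → V`, apply this in `V × W^q` to the range of `(f, incl)`.
The resulting subspace projects onto `W^q`, which is generated by its highest vector, and its
dimension is at most `4 (n + 1) ≤ dim W^q`. It is therefore the graph of the required homomorphism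
(`exists_extension`).

An invariant subspace of `W^q` contains the weight components of its vectors, and `E₁₂`, `E₂₃` move
these up to the highest vector unless a factor `ξ` or `η` vanishes. So the largest proper invariant
subspace is `0`, `I_1^q` or `I_2^q`. The numbers `ξ` and `η` never vanish together.

An irreducible representation has a weight vector killed by `E₁₂` and `E₂₃`. Powers of `E₂₁`
eventually kill it, and regularity turns this into `c₁ - c₂ = n`, a signature. The even map from
`V^q` extends to `W^q`; its extension is onto by irreducibility, with the largest proper invariant
subspace as kernel. Conversely, relations pass to images because intertwining maps respect the
operator exponential, and regularity holds because `H₁` has integer eigenvalues on `W^q`. -/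

namespace UqGL21

/-! ### Functoriality of the operator exponential -/

section Functoriality

variable {V W : Type*} [AddCommGroup V] [Module ℂ V] [AddCommGroup W] [Module ℂ W]

theorem hasSum_matrix_exp {m : Type*} [Fintype m] [DecidableEq m] (M : Matrix m m ℂ) :
    HasSum (fun k : ℕ => ((k.factorial : ℂ)⁻¹) • M ^ k) (NormedSpace.exp M) :=
  open scoped Matrix.Norms.Operator in NormedSpace.exp_series_hasSum_exp' M

/-- The matrix `F` is rectangular, so the two exponentials live in different algebras; the two
series are compared term by term through the continuous maps given by multiplication by `F`. -/
theorem matrix_mul_exp {m n : Type*} [Fintype m] [DecidableEq m] [Fintype n] [DecidableEq n]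
    (F : Matrix n m ℂ) (M : Matrix m m ℂ) (N : Matrix n n ℂ) (hF : F * M = N * F) :
    F * NormedSpace.exp M = NormedSpace.exp N * F := by
  have hpow : ∀ k : ℕ, F * M ^ k = N ^ k * F := by
    intro k
    induction k with
    | zero => simp
    | succ k ih => rw [pow_succ, ← Matrix.mul_assoc, ih, Matrix.mul_assoc, hF, pow_succ,
        Matrix.mul_assoc]
  have h1 := (hasSum_matrix_exp M).map (Matrix.addMonoidHomMulLeft F)
    (continuous_const.matrix_mul continuous_id)
  have h2 := (hasSum_matrix_exp N).map (Matrix.addMonoidHomMulRight F)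
    (continuous_id.matrix_mul continuous_const)
  refine h1.unique ?_
  convert h2 using 1
  · funext k
    simp [Matrix.addMonoidHomMulLeft, Matrix.addMonoidHomMulRight, hpow]
  · rfl

/-- The linear map `f` intertwines the operators `A` and `B`. -/
def Sem (f : V →ₗ[ℂ] W) (A : Module.End ℂ V) (B : Module.End ℂ W) : Prop :=
  ∀ v, f (A v) = B (f v)

variable {f : V →ₗ[ℂ] W} {A A' : Module.End ℂ V} {B B' : Module.End ℂ W}

theorem Sem.add (h : Sem f A B) (h' : Sem f A' B') : Sem f (A + A') (B + B') :=
  fun v => by simp [h v, h' v]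

theorem Sem.sub (h : Sem f A B) (h' : Sem f A' B') : Sem f (A - A') (B - B') :=
  fun v => by simp [h v, h' v]

theorem Sem.neg (h : Sem f A B) : Sem f (-A) (-B) :=
  fun v => by simp [h v]

theorem Sem.mul (h : Sem f A B) (h' : Sem f A' B') : Sem f (A * A') (B * B') :=
  fun v => by simp [h _, h' v]

theorem Sem.smul (c : ℂ) (h : Sem f A B) : Sem f (c • A) (c • B) :=
  fun v => by simp [h v]

theorem Sem.zero : Sem f 0 0 := fun v => by simp

theorem Sem.brk (r : ℂ) (h : Sem f A B) (h' : Sem f A' B') :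
    Sem f (brk r A A') (brk r B B') :=
  (h.mul h').sub ((h'.mul h).smul r)

theorem Sem.eq_of_surjective (hf : Function.Surjective f) (h : Sem f A B) (h' : Sem f A' B')
    (e : A = A') : B = B' := by
  ext w
  obtain ⟨v, rfl⟩ := hf w
  rw [← h v, ← h' v, e]

variable [FiniteDimensional ℂ V] [FiniteDimensional ℂ W]

/-- This removes the dependence of `expEnd` on a chosen basis. Applied to a line, to an invariant
subspace, to a quotient map or to a projection, it gives all that is used about `[H]`. -/
theorem Sem.expEnd (h : Sem f A B) : Sem f (expEnd A) (expEnd B) := by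
  set bV := Module.finBasis ℂ V
  set bW := Module.finBasis ℂ W
  have h0 : f ∘ₗ A = B ∘ₗ f := LinearMap.ext h
  have h1 : LinearMap.toMatrix bV bW f * LinearMap.toMatrixAlgEquiv bV A =
      LinearMap.toMatrixAlgEquiv bW B * LinearMap.toMatrix bV bW f := by
    have := congrArg (LinearMap.toMatrix bV bW) h0
    rwa [LinearMap.toMatrix_comp bV bV bW, LinearMap.toMatrix_comp bV bW bW] at this
  have h2 := matrix_mul_exp _ _ _ h1
  have key : f ∘ₗ UqGL21.expEnd A = UqGL21.expEnd B ∘ₗ f := by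
    apply (LinearMap.toMatrix bV bW).injective
    rw [LinearMap.toMatrix_comp bV bV bW, LinearMap.toMatrix_comp bV bW bW]
    have e1 : LinearMap.toMatrix bV bV (UqGL21.expEnd A) =
        NormedSpace.exp (LinearMap.toMatrixAlgEquiv bV A) :=
      (LinearMap.toMatrixAlgEquiv bV).apply_symm_apply _
    have e2 : LinearMap.toMatrix bW bW (UqGL21.expEnd B) =
        NormedSpace.exp (LinearMap.toMatrixAlgEquiv bW B) :=
      (LinearMap.toMatrixAlgEquiv bW).apply_symm_apply _
    rw [e1, e2, h2]
  exact fun v => LinearMap.congr_fun key v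

theorem Sem.qnOp (h : ℂ) (hf : Sem f A B) : Sem f (qnOp h A) (qnOp h B) :=
  ((hf.smul h).expEnd.sub (hf.smul h).neg.expEnd).smul _

theorem expEnd_algebraMap_one (c : ℂ) :
    expEnd (c • (1 : Module.End ℂ ℂ)) = Complex.exp c • 1 := by
  have : LinearMap.toMatrixAlgEquiv (Module.finBasis ℂ ℂ) (c • 1) =
      Matrix.diagonal fun _ => c := by
    rw [map_smul, map_one, ← Matrix.smul_one_eq_diagonal]
  rw [UqGL21.expEnd, this, Matrix.exp_diagonal, AlgEquiv.symm_apply_eq, map_smul, map_one,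
    Matrix.smul_one_eq_diagonal]
  congr 1
  funext i
  rw [Pi.coe_exp, Complex.exp_eq_exp_ℂ]

theorem expEnd_apply_of_eigen {c : ℂ} {v : V} (hv : A v = c • v) :
    expEnd A v = Complex.exp c • v := by
  -- The eigenvector equation says that `z ↦ z • v` intertwines the scalar `c` on `ℂ` with `A`.
  have hs : Sem (LinearMap.toSpanSingleton ℂ V v) (c • 1) A := by
    intro z
    simp [hv, mul_smul, smul_comm c z v]
  have := hs.expEnd 1
  rw [expEnd_algebraMap_one] at this
  simpa using this.symm

theorem qnOp_apply_of_eigen (h : ℂ) {c : ℂ} {v : V} (hv : A v = c • v) :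
    qnOp h A v = qn h c • v := by
  have h1 : (h • A) v = (h * c) • v := by simp [hv, mul_smul]
  have h2 : (-(h • A)) v = (-(h * c)) • v := by simp [hv, mul_smul]
  rw [UqGL21.qnOp, LinearMap.smul_apply, LinearMap.sub_apply, expEnd_apply_of_eigen h1,
    expEnd_apply_of_eigen h2, ← sub_smul, smul_smul, qn, div_eq_inv_mul]

theorem qnOp_mem {N : Submodule ℂ V} (hN : ∀ v ∈ N, A v ∈ N) (h : ℂ) :
    ∀ v ∈ N, qnOp h A v ∈ N := by
  intro v hv
  have hs : Sem N.subtype (A.restrict hN) A := fun v => rfl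
  have := hs.qnOp h ⟨v, hv⟩
  rw [Submodule.subtype_apply, Submodule.subtype_apply] at this
  rw [← this]
  exact (UqGL21.qnOp h (A.restrict hN) ⟨v, hv⟩).2

end Functoriality

/-! ### Images and products of representations -/

section Transport

variable {V W : Type*} [AddCommGroup V] [Module ℂ V] [AddCommGroup W] [Module ℂ W]

section

variable [FiniteDimensional ℂ V] [FiniteDimensional ℂ W]

/-- Both sides of each relation are built from the generators by operations that `Sem` respects, and
an operator on `W` is determined by its composite with a surjection. -/
theorem IsRep.of_surjective {h : ℂ} {ρ : Ops V} {σ : Ops W} (hρ : ρ.IsRep h) {f : V →ₗ[ℂ] W}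
    (hf : Intertwines ρ σ f) (hs : Function.Surjective f) : σ.IsRep h := by
  have s11 : Sem f ρ.E11 σ.E11 := hf.E11
  have s22 : Sem f ρ.E22 σ.E22 := hf.E22
  have s33 : Sem f ρ.E33 σ.E33 := hf.E33
  have s12 : Sem f ρ.E12 σ.E12 := hf.E12
  have s21 : Sem f ρ.E21 σ.E21 := hf.E21
  have s23 : Sem f ρ.E23 σ.E23 := hf.E23
  have s32 : Sem f ρ.E32 σ.E32 := hf.E32
  have s13 : Sem f (ρ.E13 h) (σ.E13 h) := s12.brk _ s23
  have s31 : Sem f (ρ.E31 h) (σ.E31 h) := (s21.brk _ s32).neg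
  exact
    { cartan12 := (s11.brk _ s22).eq_of_surjective hs .zero hρ.cartan12
      cartan13 := (s11.brk _ s33).eq_of_surjective hs .zero hρ.cartan13
      cartan23 := (s22.brk _ s33).eq_of_surjective hs .zero hρ.cartan23
      wt11_12 := (s11.brk _ s12).eq_of_surjective hs s12 hρ.wt11_12
      wt22_12 := (s22.brk _ s12).eq_of_surjective hs s12.neg hρ.wt22_12
      wt33_12 := (s33.brk _ s12).eq_of_surjective hs .zero hρ.wt33_12
      wt11_23 := (s11.brk _ s23).eq_of_surjective hs .zero hρ.wt11_23
      wt22_23 := (s22.brk _ s23).eq_of_surjective hs s23 hρ.wt22_23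
      wt33_23 := (s33.brk _ s23).eq_of_surjective hs s23.neg hρ.wt33_23
      wt11_21 := (s11.brk _ s21).eq_of_surjective hs s21.neg hρ.wt11_21
      wt22_21 := (s22.brk _ s21).eq_of_surjective hs s21 hρ.wt22_21
      wt33_21 := (s33.brk _ s21).eq_of_surjective hs .zero hρ.wt33_21
      wt11_32 := (s11.brk _ s32).eq_of_surjective hs .zero hρ.wt11_32
      wt22_32 := (s22.brk _ s32).eq_of_surjective hs s32.neg hρ.wt22_32
      wt33_32 := (s33.brk _ s32).eq_of_surjective hs s32 hρ.wt33_32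
      comm12_21 := (s12.brk _ s21).eq_of_surjective hs ((s11.sub s22).qnOp h) hρ.comm12_21
      anticomm23_32 := (s23.brk _ s32).eq_of_surjective hs ((s22.add s33).qnOp h)
        hρ.anticomm23_32
      comm12_32 := (s12.brk _ s32).eq_of_surjective hs .zero hρ.comm12_32
      comm23_21 := (s23.brk _ s21).eq_of_surjective hs .zero hρ.comm23_21
      sq23 := (s23.mul s23).eq_of_surjective hs .zero hρ.sq23
      sq32 := (s32.mul s32).eq_of_surjective hs .zero hρ.sq32
      serre12 := (s12.brk _ s13).eq_of_surjective hs .zero hρ.serre12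
      serre21 := (s21.brk _ s31).eq_of_surjective hs .zero hρ.serre21 }

end

/-- The direct sum of two systems of operators. -/
def Ops.prod (ρ : Ops V) (σ : Ops W) : Ops (V × W) where
  E11 := ρ.E11.prodMap σ.E11
  E22 := ρ.E22.prodMap σ.E22
  E33 := ρ.E33.prodMap σ.E33
  E12 := ρ.E12.prodMap σ.E12
  E21 := ρ.E21.prodMap σ.E21
  E23 := ρ.E23.prodMap σ.E23
  E32 := ρ.E32.prodMap σ.E32

theorem eq_of_sem_fst_snd {A A' : Module.End ℂ (V × W)} {B : Module.End ℂ V}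
    {C : Module.End ℂ W} (h1 : Sem (LinearMap.fst ℂ V W) A B)
    (h2 : Sem (LinearMap.snd ℂ V W) A C) (h1' : Sem (LinearMap.fst ℂ V W) A' B)
    (h2' : Sem (LinearMap.snd ℂ V W) A' C) : A = A' :=
  LinearMap.ext fun v => Prod.ext ((h1 v).trans (h1' v).symm) ((h2 v).trans (h2' v).symm)

theorem intertwines_snd (ρ : Ops V) (σ : Ops W) :
    Intertwines (ρ.prod σ) σ (LinearMap.snd ℂ V W) :=
  ⟨⟨fun _ => rfl, fun _ => rfl, fun _ => rfl, fun _ => rfl, fun _ => rfl⟩, fun _ => rfl,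
    fun _ => rfl⟩

/-- An operator on `V × W` is determined by its composites with the two projections, both of which
intertwine. The product is the ambient space of the graph argument. -/
theorem isRep_prod [FiniteDimensional ℂ V] [FiniteDimensional ℂ W] {h : ℂ} {ρ : Ops V}
    {σ : Ops W} (hρ : ρ.IsRep h) (hσ : σ.IsRep h) : (ρ.prod σ).IsRep h := by
  have key : ∀ {A A' : Module.End ℂ (V × W)} {B B' : Module.End ℂ V}
      {C C' : Module.End ℂ W}, (Sem (LinearMap.fst ℂ V W) A B ∧ Sem (LinearMap.snd ℂ V W) A C) →
      (Sem (LinearMap.fst ℂ V W) A' B' ∧ Sem (LinearMap.snd ℂ V W) A' C') →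
      B = B' → C = C' → A = A' := by
    rintro A A' B _ C _ ⟨h1, h2⟩ ⟨h3, h4⟩ rfl rfl
    exact eq_of_sem_fst_snd h1 h2 h3 h4
  have hz : Sem (LinearMap.fst ℂ V W) 0 0 ∧ Sem (LinearMap.snd ℂ V W) 0 0 := ⟨.zero, .zero⟩
  have s11 : Sem (LinearMap.fst ℂ V W) (ρ.prod σ).E11 ρ.E11 := fun _ => rfl
  have t11 : Sem (LinearMap.snd ℂ V W) (ρ.prod σ).E11 σ.E11 := fun _ => rfl
  have s22 : Sem (LinearMap.fst ℂ V W) (ρ.prod σ).E22 ρ.E22 := fun _ => rfl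
  have t22 : Sem (LinearMap.snd ℂ V W) (ρ.prod σ).E22 σ.E22 := fun _ => rfl
  have s33 : Sem (LinearMap.fst ℂ V W) (ρ.prod σ).E33 ρ.E33 := fun _ => rfl
  have t33 : Sem (LinearMap.snd ℂ V W) (ρ.prod σ).E33 σ.E33 := fun _ => rfl
  have s12 : Sem (LinearMap.fst ℂ V W) (ρ.prod σ).E12 ρ.E12 := fun _ => rfl
  have t12 : Sem (LinearMap.snd ℂ V W) (ρ.prod σ).E12 σ.E12 := fun _ => rfl
  have s21 : Sem (LinearMap.fst ℂ V W) (ρ.prod σ).E21 ρ.E21 := fun _ => rfl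
  have t21 : Sem (LinearMap.snd ℂ V W) (ρ.prod σ).E21 σ.E21 := fun _ => rfl
  have s23 : Sem (LinearMap.fst ℂ V W) (ρ.prod σ).E23 ρ.E23 := fun _ => rfl
  have t23 : Sem (LinearMap.snd ℂ V W) (ρ.prod σ).E23 σ.E23 := fun _ => rfl
  have s32 : Sem (LinearMap.fst ℂ V W) (ρ.prod σ).E32 ρ.E32 := fun _ => rfl
  have t32 : Sem (LinearMap.snd ℂ V W) (ρ.prod σ).E32 σ.E32 := fun _ => rfl
  have s13 : Sem (LinearMap.fst ℂ V W) ((ρ.prod σ).E13 h) (ρ.E13 h) := s12.brk _ s23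
  have s31 : Sem (LinearMap.fst ℂ V W) ((ρ.prod σ).E31 h) (ρ.E31 h) := (s21.brk _ s32).neg
  have t13 : Sem (LinearMap.snd ℂ V W) ((ρ.prod σ).E13 h) (σ.E13 h) := t12.brk _ t23
  have t31 : Sem (LinearMap.snd ℂ V W) ((ρ.prod σ).E31 h) (σ.E31 h) := (t21.brk _ t32).neg
  exact
    { cartan12 := key ⟨(s11.brk _ s22), (t11.brk _ t22)⟩ hz hρ.cartan12 hσ.cartan12
      cartan13 := key ⟨(s11.brk _ s33), (t11.brk _ t33)⟩ hz hρ.cartan13 hσ.cartan13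
      cartan23 := key ⟨(s22.brk _ s33), (t22.brk _ t33)⟩ hz hρ.cartan23 hσ.cartan23
      wt11_12 := key ⟨(s11.brk _ s12), (t11.brk _ t12)⟩ ⟨s12, t12⟩ hρ.wt11_12 hσ.wt11_12
      wt22_12 := key ⟨(s22.brk _ s12), (t22.brk _ t12)⟩ ⟨s12.neg, t12.neg⟩ hρ.wt22_12 hσ.wt22_12
      wt33_12 := key ⟨(s33.brk _ s12), (t33.brk _ t12)⟩ hz hρ.wt33_12 hσ.wt33_12
      wt11_23 := key ⟨(s11.brk _ s23), (t11.brk _ t23)⟩ hz hρ.wt11_23 hσ.wt11_23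
      wt22_23 := key ⟨(s22.brk _ s23), (t22.brk _ t23)⟩ ⟨s23, t23⟩ hρ.wt22_23 hσ.wt22_23
      wt33_23 := key ⟨(s33.brk _ s23), (t33.brk _ t23)⟩ ⟨s23.neg, t23.neg⟩ hρ.wt33_23 hσ.wt33_23
      wt11_21 := key ⟨(s11.brk _ s21), (t11.brk _ t21)⟩ ⟨s21.neg, t21.neg⟩ hρ.wt11_21 hσ.wt11_21
      wt22_21 := key ⟨(s22.brk _ s21), (t22.brk _ t21)⟩ ⟨s21, t21⟩ hρ.wt22_21 hσ.wt22_21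
      wt33_21 := key ⟨(s33.brk _ s21), (t33.brk _ t21)⟩ hz hρ.wt33_21 hσ.wt33_21
      wt11_32 := key ⟨(s11.brk _ s32), (t11.brk _ t32)⟩ hz hρ.wt11_32 hσ.wt11_32
      wt22_32 := key ⟨(s22.brk _ s32), (t22.brk _ t32)⟩ ⟨s32.neg, t32.neg⟩ hρ.wt22_32 hσ.wt22_32
      wt33_32 := key ⟨(s33.brk _ s32), (t33.brk _ t32)⟩ ⟨s32, t32⟩ hρ.wt33_32 hσ.wt33_32
      comm12_21 := key ⟨(s12.brk _ s21), (t12.brk _ t21)⟩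
        ⟨(s11.sub s22).qnOp h, (t11.sub t22).qnOp h⟩ hρ.comm12_21 hσ.comm12_21
      anticomm23_32 := key ⟨(s23.brk _ s32), (t23.brk _ t32)⟩
        ⟨(s22.add s33).qnOp h, (t22.add t33).qnOp h⟩ hρ.anticomm23_32 hσ.anticomm23_32
      comm12_32 := key ⟨(s12.brk _ s32), (t12.brk _ t32)⟩ hz hρ.comm12_32 hσ.comm12_32
      comm23_21 := key ⟨(s23.brk _ s21), (t23.brk _ t21)⟩ hz hρ.comm23_21 hσ.comm23_21
      sq23 := key ⟨(s23.mul s23), (t23.mul t23)⟩ hz hρ.sq23 hσ.sq23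
      sq32 := key ⟨(s32.mul s32), (t32.mul t32)⟩ hz hρ.sq32 hσ.sq32
      serre12 := key ⟨(s12.brk _ s13), (t12.brk _ t13)⟩ hz hρ.serre12 hσ.serre12
      serre21 := key ⟨(s21.brk _ s31), (t21.brk _ t31)⟩ hz hρ.serre21 hσ.serre21 }

end Transport

/-! ### `q`-number identities -/

section QNumbers

variable {h : ℂ}

theorem Generic.exp_sub_ne (hq : Generic h) {k : ℤ} (hk : k ≠ 0) :
    Complex.exp (h * k) - Complex.exp (-(h * k)) ≠ 0 := by
  intro h0
  have h1 : Complex.exp (h * k) * Complex.exp (h * k) = 1 := by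
    rw [sub_eq_zero] at h0
    nth_rewrite 2 [h0]
    rw [← Complex.exp_add, add_neg_cancel, Complex.exp_zero]
  have h2 : Complex.exp h ^ (2 * k) = 1 := by
    rw [← Complex.exp_int_mul, ← h1, ← Complex.exp_add]
    congr 1
    push_cast
    ring
  have h3 : Complex.exp h ^ (2 * k).natAbs = 1 := by
    rcases Int.natAbs_eq (2 * k) with e | e
    · rw [e, zpow_natCast] at h2
      exact h2
    · rw [e, zpow_neg, zpow_natCast, inv_eq_one] at h2
      exact h2
  exact hq _ (by omega) h3

theorem Generic.denom_ne (hq : Generic h) : Complex.exp h - Complex.exp (-h) ≠ 0 := by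
  simpa using hq.exp_sub_ne one_ne_zero

theorem qn_int_ne (hq : Generic h) {k : ℤ} (hk : k ≠ 0) : qn h k ≠ 0 :=
  div_ne_zero (hq.exp_sub_ne hk) hq.denom_ne

theorem qn_nat_ne (hq : Generic h) {k : ℕ} (hk : k ≠ 0) : qn h k ≠ 0 := by
  simpa using qn_int_ne hq (k := k) (by exact_mod_cast hk)

@[simp] theorem qn_zero (h : ℂ) : qn h 0 = 0 := by simp [qn]

@[simp] theorem rt_zero (h : ℂ) : rt h 0 = 0 := by simp [rt]

theorem rt_sq (h x : ℂ) : rt h x ^ 2 = qn h x := by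
  rw [rt, ← Complex.cpow_nat_mul]
  norm_num

theorem rt_ne {x : ℂ} (hx : qn h x ≠ 0) : rt h x ≠ 0 := by
  intro h0
  rw [← rt_sq, h0] at hx
  simp at hx

theorem rt_nat_ne (hq : Generic h) {k : ℕ} (hk : k ≠ 0) : rt h k ≠ 0 := rt_ne (qn_nat_ne hq hk)

/-- The addition formula behind every `[E₁₂, E₂₁]` computation. Once the exponentials of sums are
expanded, it is an identity of rational functions in `q`, `q ^ p`, `q ^ r`. -/
theorem qn_succ_mul_sub (hq : Generic h) (p r : ℂ) :
    qn h (p + 1) * qn h r - qn h p * qn h (r + 1) = qn h (r - p) := by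
  have hd := hq.denom_ne
  simp only [qn, mul_add, mul_sub, mul_one, neg_add, neg_sub, Complex.exp_add, Complex.exp_sub]
  rw [Complex.exp_neg] at hd
  simp only [Complex.exp_neg]
  have e1 := Complex.exp_ne_zero h
  have hd' : Complex.exp h ^ 2 - 1 ≠ 0 := fun e => hd (by field_simp; linear_combination e)
  have e2 := Complex.exp_ne_zero (h * p)
  have e3 := Complex.exp_ne_zero (h * r)
  field_simp
  ring

/-- At `i = 0` and `i = n + 1` one term on the left vanishes, so `[x + i]` interpolates between
`[x]` and `[x + n + 1]`, which will be `ξ` and `η`. -/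
theorem qn_interpolate (hq : Generic h) (n i x : ℂ) :
    qn h (n + 1 - i) * qn h x + qn h i * qn h (x + n + 1) = qn h (n + 1) * qn h (x + i) := by
  have hd := hq.denom_ne
  simp only [qn, mul_add, mul_sub, mul_one, neg_add, neg_sub, Complex.exp_add, Complex.exp_sub]
  rw [Complex.exp_neg] at hd
  simp only [Complex.exp_neg]
  have e1 := Complex.exp_ne_zero h
  have hd' : Complex.exp h ^ 2 - 1 ≠ 0 := fun e => hd (by field_simp; linear_combination e)
  have e2 := Complex.exp_ne_zero (h * i)
  have e3 := Complex.exp_ne_zero (h * x)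
  have e4 := Complex.exp_ne_zero (h * n)
  field_simp
  ring

/-- As functions of `m`, both `q ^ m` and `q ^ (-m)` solve the recursion with characteristic roots
`q` and `q⁻¹`. -/
theorem qn_three_term (h m : ℂ) :
    qn h (m + 2) + qn h m = (Complex.exp h + (Complex.exp h)⁻¹) * qn h (m + 1) := by
  have e : h * 2 = h + h := by ring
  simp only [qn, mul_add, mul_one, neg_add, e, Complex.exp_add, Complex.exp_neg]
  have e1 := Complex.exp_ne_zero h
  have e2 := Complex.exp_ne_zero (h * m)
  field_simp
  ring

/-- Otherwise `q ^ 2 = -1`, and `q` is a fourth root of unity. -/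
theorem Generic.exp_add_inv_ne (hq : Generic h) : Complex.exp h + (Complex.exp h)⁻¹ ≠ 0 := by
  intro h0
  have e1 := Complex.exp_ne_zero h
  field_simp at h0
  refine hq 4 (by norm_num) ?_
  linear_combination (Complex.exp h ^ 2 - 1) * h0

end QNumbers

/-! ### The action on the vectors `(m)_k` -/

namespace Signature

variable (S : Signature)

theorem wvec_eq_zero {k : Fin 4} {i : ℕ} (hi : ¬(top k ≤ i ∧ i ≤ S.n + bot k)) :
    S.wvec k i = 0 := by
  funext p
  obtain ⟨⟨k', i'⟩, hp⟩ := p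
  simp only [wvec, Pi.zero_apply, ite_eq_right_iff, one_ne_zero, imp_false, not_and]
  rintro rfl rfl
  exact hi hp

theorem bot_le (k : Fin 4) : bot k ≤ 1 := by fin_cases k <;> decide

theorem wvec_eq_single {k : Fin 4} {i : ℕ} (hi : top k ≤ i ∧ i ≤ S.n + bot k) :
    S.wvec k i = Pi.single (⟨(k, ⟨i, by have := bot_le k; omega⟩), hi⟩ : Label S.n) 1 := by
  funext p
  obtain ⟨⟨k', i'⟩, hp⟩ := p
  simp [wvec, Pi.single_apply, Subtype.ext_iff, Prod.ext_iff, Fin.ext_iff]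

theorem wvec_label (p : Label S.n) : S.wvec p.1.1 p.1.2 = Pi.single p 1 :=
  S.wvec_eq_single p.2

theorem w_ext {X : Type*} [AddCommGroup X] [Module ℂ X] {A B : S.WSpace →ₗ[ℂ] X}
    (hAB : ∀ k i, A (S.wvec k i) = B (S.wvec k i)) : A = B := by
  refine (Pi.basisFun ℂ (Label S.n)).ext fun p => ?_
  rw [Pi.basisFun_apply, ← wvec_label]
  exact hAB _ _

/-- Checking once that `F` vanishes at labels without a pattern makes the formula valid for all `i :
ℕ`, so later computations carry no range conditions. -/
theorem wOp_wvec {F : Fin 4 → ℕ → S.WSpace}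
    (hF : ∀ k i, ¬(top k ≤ i ∧ i ≤ S.n + bot k) → F k i = 0) (k : Fin 4) (i : ℕ) :
    S.wOp F (S.wvec k i) = F k i := by
  by_cases hi : top k ≤ i ∧ i ≤ S.n + bot k
  · rw [S.wvec_eq_single hi, ← Pi.basisFun_apply, wOp, Module.Basis.constr_basis]
  · rw [S.wvec_eq_zero hi, hF k i hi, map_zero]

theorem m13_eq : S.m13 = S.m23 + S.n := by rw [← S.sub_eq]; ring

variable (h a₁ a₂ a₃ : ℂ)

/-- `[i] ^ (1/2)`, that is `[l₁₃ - l₁₁] ^ (1/2)`. -/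
noncomputable def rr (i : ℕ) : ℂ := rt h i

/-- `[n + 1 - i] ^ (1/2)`, that is `[l₁₁ - l₂₃] ^ (1/2)`. -/
noncomputable def ss (i : ℕ) : ℂ := rt h (S.n + 1 - i)

/-- `[2l] ^ (1/2)`, replaced by `1` for `2l = 0`. -/
noncomputable def nu : ℂ := if S.n = 0 then 1 else rt h S.n

/-- The `q`-number `ξ`. -/
noncomputable def xi : ℂ := qn h (S.l23 + S.l33 + 3)

/-- The `q`-number `η`. -/
noncomputable def eta : ℂ := qn h (S.l13 + S.l33 + 3)

@[simp] theorem rr_zero : rr h 0 = 0 := by simp [rr]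

@[simp] theorem ss_last : S.ss h (S.n + 1) = 0 := by simp [ss]

theorem rr_sq (i : ℕ) : rr h i ^ 2 = qn h i := rt_sq _ _

theorem ss_sq (i : ℕ) : S.ss h i ^ 2 = qn h (S.n + 1 - i) := rt_sq _ _

theorem E11_wvec (k : Fin 4) (i : ℕ) :
    (S.Wq h a₁ a₂ a₃).E11 (S.wvec k i) = S.m11 i • S.wvec k i :=
  S.wOp_wvec (F := fun k i => S.m11 i • S.wvec k i)
    (fun k i hi => by rw [S.wvec_eq_zero hi, smul_zero]) k i

theorem E22_wvec (k : Fin 4) (i : ℕ) :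
    (S.Wq h a₁ a₂ a₃).E22 (S.wvec k i) = (S.m12 k + S.m22 k - S.m11 i) • S.wvec k i :=
  S.wOp_wvec (F := fun k i => (S.m12 k + S.m22 k - S.m11 i) • S.wvec k i)
    (fun k i hi => by rw [S.wvec_eq_zero hi, smul_zero]) k i

theorem E33_wvec (k : Fin 4) (i : ℕ) :
    (S.Wq h a₁ a₂ a₃).E33 (S.wvec k i) = S.m32 k • S.wvec k i :=
  S.wOp_wvec (F := fun k i => S.m32 k • S.wvec k i)
    (fun k i hi => by rw [S.wvec_eq_zero hi, smul_zero]) k i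

theorem E12_wvec (k : Fin 4) (i : ℕ) :
    (S.Wq h a₁ a₂ a₃).E12 (S.wvec k i) =
      c12 h (S.m12 k) (S.m22 k) (S.m11 i) • S.wvec k (i - 1) := by
  refine S.wOp_wvec (F := fun k i => c12 h (S.m12 k) (S.m22 k) (S.m11 i) • S.wvec k (i - 1))
    (fun k i hi => ?_) k i
  -- One step below the last pattern the target vector `i - 1` exists, and it is the factor `[0]`
  -- that vanishes; elsewhere out of range the target is zero.
  by_cases hi' : i = S.n + bot k + 1
  · have : S.m11 i - 1 - (S.m22 k - 2) = 0 := by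
      rw [m11, m22, m13_eq, hi']
      push_cast
      ring
    simp [c12, this]
  · rw [S.wvec_eq_zero (by omega), smul_zero]

theorem E21_wvec (k : Fin 4) (i : ℕ) :
    (S.Wq h a₁ a₂ a₃).E21 (S.wvec k i) =
      c21 h (S.m12 k) (S.m22 k) (S.m11 i) • S.wvec k (i + 1) := by
  refine S.wOp_wvec (F := fun k i => c21 h (S.m12 k) (S.m22 k) (S.m11 i) • S.wvec k (i + 1))
    (fun k i hi => ?_) k i
  -- Just above the first pattern the target exists and the coefficient contains `[0]`.
  by_cases hi' : i + 1 = top k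
  · have : S.m12 k - 1 - (S.m11 i - 1) + 1 = 0 := by
      rw [m11, m12, ← hi']
      push_cast
      ring
    rw [c21, this, rt_zero, zero_mul, zero_smul]
  · rw [S.wvec_eq_zero (by omega), smul_zero]

/-- The truncated `0 - 1 = 0` would return the same vector; either its coefficient contains `[0]` or
the vector does not exist. -/
theorem E12_zero (k : Fin 4) : (S.Wq h a₁ a₂ a₃).E12 (S.wvec k 0) = 0 := by
  rw [E12_wvec]
  by_cases hk : top k = 0
  · simp [c12, m12, m11, hk]
  · rw [S.wvec_eq_zero (by omega), smul_zero]

/-- In this and the seven formulas below, the index of `rr` drops by `top k` and that of `ss` by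
`bot k`. -/
theorem E12_0 (i : ℕ) : (S.Wq h a₁ a₂ a₃).E12 (S.wvec 0 (i + 1)) =
    (rr h (i + 1) * S.ss h (i + 1)) • S.wvec 0 i := by
  rw [E12_wvec, c12, rr, ss, Nat.add_sub_cancel, m12, m22, m11, m13_eq]
  congr 3 <;> simp only [top, bot, Matrix.cons_val] <;> push_cast <;> ring

theorem E12_1 (i : ℕ) : (S.Wq h a₁ a₂ a₃).E12 (S.wvec 1 (i + 1)) =
    (rr h (i + 1) * S.ss h i) • S.wvec 1 i := by
  rw [E12_wvec, c12, rr, ss, Nat.add_sub_cancel, m12, m22, m11, m13_eq]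
  congr 3 <;> simp only [top, bot, Matrix.cons_val] <;> push_cast <;> ring

theorem E12_2 (i : ℕ) : (S.Wq h a₁ a₂ a₃).E12 (S.wvec 2 (i + 1)) =
    (rr h i * S.ss h (i + 1)) • S.wvec 2 i := by
  rw [E12_wvec, c12, rr, ss, Nat.add_sub_cancel, m12, m22, m11, m13_eq]
  congr 3 <;> simp only [top, bot, Matrix.cons_val] <;> push_cast <;> ring

theorem E12_3 (i : ℕ) : (S.Wq h a₁ a₂ a₃).E12 (S.wvec 3 (i + 1)) =
    (rr h i * S.ss h i) • S.wvec 3 i := by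
  rw [E12_wvec, c12, rr, ss, Nat.add_sub_cancel, m12, m22, m11, m13_eq]
  congr 3 <;> simp only [top, bot, Matrix.cons_val] <;> push_cast <;> ring

theorem E21_0 (i : ℕ) : (S.Wq h a₁ a₂ a₃).E21 (S.wvec 0 i) =
    (rr h (i + 1) * S.ss h (i + 1)) • S.wvec 0 (i + 1) := by
  rw [E21_wvec, c21, rr, ss, m12, m22, m11, m13_eq]
  congr 3 <;> simp only [top, bot, Matrix.cons_val] <;> push_cast <;> ring

theorem E21_1 (i : ℕ) : (S.Wq h a₁ a₂ a₃).E21 (S.wvec 1 i) =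
    (rr h (i + 1) * S.ss h i) • S.wvec 1 (i + 1) := by
  rw [E21_wvec, c21, rr, ss, m12, m22, m11, m13_eq]
  congr 3 <;> simp only [top, bot, Matrix.cons_val] <;> push_cast <;> ring

theorem E21_2 (i : ℕ) : (S.Wq h a₁ a₂ a₃).E21 (S.wvec 2 i) =
    (rr h i * S.ss h (i + 1)) • S.wvec 2 (i + 1) := by
  rw [E21_wvec, c21, rr, ss, m12, m22, m11, m13_eq]
  congr 3 <;> simp only [top, bot, Matrix.cons_val] <;> push_cast <;> ring

theorem E21_3 (i : ℕ) : (S.Wq h a₁ a₂ a₃).E21 (S.wvec 3 i) =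
    (rr h i * S.ss h i) • S.wvec 3 (i + 1) := by
  rw [E21_wvec, c21, rr, ss, m12, m22, m11, m13_eq]
  congr 3 <;> simp only [top, bot, Matrix.cons_val] <;> push_cast <;> ring

theorem l13_sub_l11 (i : ℕ) : S.l13 - S.l11 i = i := by
  rw [l13, l11, m11]
  ring

theorem l11_sub_l23 (i : ℕ) : S.l11 i - S.l23 = S.n + 1 - i := by
  rw [l23, l11, m11, m13_eq]
  ring

theorem twol_eq : S.twol = S.n := S.sub_eq

theorem E23_wvec (k : Fin 4) (i : ℕ) :
    (S.Wq h a₁ a₂ a₃).E23 (S.wvec k i) = S.w23 h a₁ a₂ a₃ k i := by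
  refine S.wOp_wvec (fun k i hi => ?_) k i
  fin_cases k <;> simp only [w23, l13_sub_l11, l11_sub_l23] <;>
    simp only [top, bot] at hi <;> simp at hi
  · rw [S.wvec_eq_zero (by simp [top, bot]; omega), smul_zero]
  -- The vector `(m)_0` with `i = 0` exists; the coefficient is killed by `[l₁₃ - l₁₁] = [0]`.
  · by_cases h0 : i = 0
    · simp [h0]
    · rw [S.wvec_eq_zero (by simp [top, bot]; omega), smul_zero]
  · by_cases h0 : i = 0
    · subst h0
      rw [S.wvec_eq_zero (k := 2) (by simp [top, bot])]
      simp
    · rw [S.wvec_eq_zero (k := 2) (by simp [top, bot]; omega),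
        S.wvec_eq_zero (k := 1) (by simp [top, bot]; omega)]
      simp

theorem E32_wvec (k : Fin 4) (i : ℕ) :
    (S.Wq h a₁ a₂ a₃).E32 (S.wvec k i) = S.w32 h a₁ a₂ a₃ k i := by
  refine S.wOp_wvec (fun k i hi => ?_) k i
  fin_cases k <;> simp only [w32, l13_sub_l11, l11_sub_l23] <;>
    simp only [top, bot] at hi <;> simp at hi
  · rw [S.wvec_eq_zero (k := 2) (by simp [top, bot]; omega)]
    by_cases h0 : i = S.n + 1
    · simp [h0]
    · rw [S.wvec_eq_zero (k := 1) (by simp [top, bot]; omega)]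
      simp
  · rw [S.wvec_eq_zero (by simp [top, bot]; omega), smul_zero]
  · by_cases h0 : i = S.n + 1
    · simp [h0]
    · rw [S.wvec_eq_zero (by simp [top, bot]; omega), smul_zero]

theorem E23_0 (i : ℕ) : (S.Wq h a₁ a₂ a₃).E23 (S.wvec 0 i) = 0 := by
  rw [E23_wvec, w23]

theorem E23_1 (i : ℕ) : (S.Wq h a₁ a₂ a₃).E23 (S.wvec 1 i) =
    (a₁ / rt h (S.n + 1) * S.xi h * S.ss h i) • S.wvec 0 i := by
  rw [E23_wvec, w23, l11_sub_l23, twol_eq, xi, ss]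
  congr 1
  ring

theorem wvec_two_of_n_eq_zero (hn : S.n = 0) (i : ℕ) : S.wvec 2 i = 0 :=
  S.wvec_eq_zero (by simp [top, bot]; omega)

/-- For `n = 0` there are no vectors `(m)_2`, so the value `1` of `nu` is harmless, and it lets
later computations divide by `nu` in all cases. -/
theorem E23_2 (i : ℕ) : (S.Wq h a₁ a₂ a₃).E23 (S.wvec 2 i) =
    (a₂ / S.nu h * S.eta h * rr h i) • S.wvec 0 i := by
  by_cases hn : S.n = 0
  · rw [S.wvec_two_of_n_eq_zero hn, map_zero]
    rcases Nat.eq_zero_or_pos i with rfl | hi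
    · simp
    · rw [S.wvec_eq_zero (by simp [top, bot]; omega), smul_zero]
  · rw [E23_wvec, w23, l13_sub_l11, twol_eq, eta, rr, nu, if_neg hn]
    congr 1
    ring

theorem E23_3 (i : ℕ) : (S.Wq h a₁ a₂ a₃).E23 (S.wvec 3 i) =
    (a₃ / (a₁ * Complex.exp h * rt h (S.n + 1)) * S.eta h * rr h i) • S.wvec 1 i -
    (a₃ / (a₂ * Complex.exp h * qn h (S.n + 1)) * S.nu h * S.xi h * S.ss h i) • S.wvec 2 i := by
  rw [E23_wvec, w23, l13_sub_l11, l11_sub_l23, twol_eq, smul_sub, smul_smul, smul_smul]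
  congr 1
  · rw [eta, rr]
    congr 1
    ring
  · by_cases hn : S.n = 0
    · rw [S.wvec_two_of_n_eq_zero hn, smul_zero, smul_zero]
    · rw [xi, ss, nu, if_neg hn]
      congr 1
      ring

theorem E32_0 (i : ℕ) : (S.Wq h a₁ a₂ a₃).E32 (S.wvec 0 i) =
    (1 / (a₁ * rt h (S.n + 1)) * S.ss h i) • S.wvec 1 i +
    (1 / (a₂ * qn h (S.n + 1)) * S.nu h * rr h i) • S.wvec 2 i := by
  rw [E32_wvec, w32, l13_sub_l11, l11_sub_l23, twol_eq]
  congr 1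
  · rw [ss]
    congr 1
    ring
  · by_cases hn : S.n = 0
    · rw [S.wvec_two_of_n_eq_zero hn, smul_zero, smul_zero]
    · rw [rr, nu, if_neg hn]
      congr 1
      ring

theorem E32_1 (i : ℕ) : (S.Wq h a₁ a₂ a₃).E32 (S.wvec 1 i) =
    (a₁ * Complex.exp h / (a₃ * rt h (S.n + 1)) * rr h i) • S.wvec 3 i := by
  rw [E32_wvec, w32, l13_sub_l11, twol_eq, rr]
  congr 1
  ring

theorem E32_2 (i : ℕ) : (S.Wq h a₁ a₂ a₃).E32 (S.wvec 2 i) =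
    -(a₂ * Complex.exp h / (a₃ * S.nu h) * S.ss h i) • S.wvec 3 i := by
  by_cases hn : S.n = 0
  · rw [S.wvec_two_of_n_eq_zero hn, map_zero]
    by_cases hi : i = S.n + 1
    · rw [hi]
      simp
    · rw [S.wvec_eq_zero (by simp [top, bot]; omega), smul_zero]
  · rw [E32_wvec, w32, l11_sub_l23, twol_eq, ss, nu, if_neg hn]
    congr 1
    ring

theorem E32_3 (i : ℕ) : (S.Wq h a₁ a₂ a₃).E32 (S.wvec 3 i) = 0 := by
  rw [E32_wvec, w32]

theorem nu_ne (hq : Generic h) : S.nu h ≠ 0 := by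
  rw [nu]
  split_ifs with hn
  · exact one_ne_zero
  · exact rt_nat_ne hq hn

theorem qn_succ_ne (hq : Generic h) : qn h (S.n + 1) ≠ 0 := by
  simpa using qn_nat_ne hq (Nat.succ_ne_zero S.n)

theorem rt_succ_ne (hq : Generic h) : rt h (S.n + 1) ≠ 0 := rt_ne (S.qn_succ_ne h hq)

theorem rr_ne (hq : Generic h) {i : ℕ} (hi : i ≠ 0) : rr h i ≠ 0 := rt_nat_ne hq hi

theorem ss_ne (hq : Generic h) {i : ℕ} (hi : i ≤ S.n) : S.ss h i ≠ 0 := by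
  have : ((S.n : ℂ) + 1 - i) = ((S.n + 1 - i : ℕ) : ℂ) := by
    rw [Nat.cast_sub (by omega)]
    push_cast
    ring
  rw [ss, this]
  exact rt_nat_ne hq (by omega)

end Signature

/-! ### `W^q([m])` is a representation -/

namespace Signature

variable (S : Signature) {h a₁ a₂ a₃ : ℂ}

theorem brk_apply {V : Type*} [AddCommGroup V] [Module ℂ V] (r : ℂ) (A B : Module.End ℂ V)
    (v : V) : brk r A B v = A (B v) - r • B (A v) := rfl

theorem H1_wvec (k : Fin 4) (i : ℕ) : (S.Wq h a₁ a₂ a₃).H1 (S.wvec k i) =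
    ((S.n : ℂ) + top k + bot k - 2 * i) • S.wvec k i := by
  rw [Ops.H1, LinearMap.sub_apply, E11_wvec, E22_wvec, ← sub_smul, m12, m22, m11, m13_eq]
  congr 1
  ring

theorem H2_wvec (k : Fin 4) (i : ℕ) : (S.Wq h a₁ a₂ a₃).H2 (S.wvec k i) =
    (S.m23 + S.m33 + i) • S.wvec k i := by
  rw [Ops.H2, LinearMap.add_apply, E22_wvec, E33_wvec, ← add_smul, m12, m22, m11, m32]
  congr 1
  ring

theorem rr_three_term (i : ℕ) : rr h (i + 2) ^ 2 + rr h i ^ 2 =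
    (Complex.exp h + (Complex.exp h)⁻¹) * rr h (i + 1) ^ 2 := by
  simp only [rr_sq]
  push_cast
  exact qn_three_term h i

theorem ss_three_term (i : ℕ) : S.ss h (i + 2) ^ 2 + S.ss h i ^ 2 =
    (Complex.exp h + (Complex.exp h)⁻¹) * S.ss h (i + 1) ^ 2 := by
  simp only [ss_sq]
  have := qn_three_term h (S.n + 1 - (i + 2))
  push_cast
  rw [← show (S.n : ℂ) + 1 - (i + 2) + 2 = S.n + 1 - i by ring, add_comm, this]
  congr 2
  ring

theorem rr_one_sq (hq : Generic h) : rr h 1 ^ 2 = 1 := by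
  rw [rr_sq]
  simp [qn, div_self hq.denom_ne]

/-- The weight `m₂₃ + m₃₃ + i` of `H₂` does not depend on `k`. It equals the argument of `ξ` at `i =
0` and that of `η` at `i = n + 1`. -/
theorem rr_ss_interpolate (hq : Generic h) (i : ℕ) :
    S.ss h i ^ 2 * S.xi h + rr h i ^ 2 * S.eta h =
      qn h (S.n + 1) * qn h (S.m23 + S.m33 + i) := by
  have e1 : S.l23 + S.l33 + 3 = S.m23 + S.m33 := by
    rw [l23, l33]
    ring
  have e2 : S.l13 + S.l33 + 3 = S.m23 + S.m33 + S.n + 1 := by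
    rw [l13, l33, m13_eq]
    ring
  rw [ss_sq, rr_sq, xi, eta, ← qn_interpolate hq, e1, e2]

/-- Two independent indices are needed because `rr` and `ss` are shifted separately in the four
`V_k^q`. -/
theorem rr_ss_commutator (hq : Generic h) (i j : ℕ) :
    rr h (i + 1) ^ 2 * S.ss h (j + 1) ^ 2 - rr h i ^ 2 * S.ss h j ^ 2 =
      qn h (S.n - j - i) := by
  simp only [rr_sq, ss_sq]
  rw [← qn_succ_mul_sub hq (i : ℂ) (S.n - j)]
  push_cast
  rw [show (S.n : ℂ) + 1 - (j + 1) = S.n - j by ring,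
    show (S.n : ℂ) + 1 - j = S.n - j + 1 by ring]

theorem Wq_comm12_21 (hq : Generic h) :
    brk 1 (S.Wq h a₁ a₂ a₃).E12 (S.Wq h a₁ a₂ a₃).E21 = qnOp h (S.Wq h a₁ a₂ a₃).H1 := by
  refine S.w_ext fun k i => ?_
  rw [qnOp_apply_of_eigen h (S.H1_wvec k i), brk_apply]
  fin_cases k <;> rcases i with _ | i <;>
    simp only [Fin.zero_eta, Fin.mk_one, Fin.reduceFinMk, E12_zero, E12_0, E12_1, E12_2, E12_3,
      E21_0, E21_1, E21_2, E21_3, map_smul, map_zero, smul_smul, smul_zero, sub_zero,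
      ← sub_smul, rr_zero, zero_mul, zero_smul, top, bot, Matrix.cons_val, one_mul]
  · have := S.rr_ss_commutator hq 0 0
    rw [rr_zero] at this
    congr 1
    push_cast at this ⊢
    ring_nf at this ⊢
    exact this
  · have := S.rr_ss_commutator hq (i + 1) (i + 1)
    congr 1
    push_cast at this ⊢
    ring_nf at this ⊢
    exact this
  -- Here `k = 1`, `i = 0`, and `rr_ss_commutator` would require `j = -1`; the claim is just `[1] [n
  -- + 1] = [n + 1]`.
  · have h1 := S.ss_sq h 0
    have h2 := rr_one_sq hq
    congr 1
    simp only [Nat.cast_zero, Nat.cast_one, sub_zero, mul_zero, add_zero, zero_add] at h1 h2 ⊢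
    rw [← h1]
    linear_combination S.ss h 0 ^ 2 * h2
  · have := S.rr_ss_commutator hq (i + 1) i
    congr 1
    push_cast at this ⊢
    ring_nf at this ⊢
    exact this
  · rw [S.wvec_eq_zero (k := 2) (by simp [top]), smul_zero]
  · have := S.rr_ss_commutator hq i (i + 1)
    congr 1
    push_cast at this ⊢
    ring_nf at this ⊢
    exact this
  · rw [S.wvec_eq_zero (k := 3) (by simp [top]), smul_zero]
  · have := S.rr_ss_commutator hq i i
    congr 1
    push_cast at this ⊢
    ring_nf at this ⊢
    exact this

theorem Wq_anticomm23_32 (hq : Generic h) (ha₁ : a₁ ≠ 0) (ha₂ : a₂ ≠ 0) (ha₃ : a₃ ≠ 0) :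
    brk (-1) (S.Wq h a₁ a₂ a₃).E23 (S.Wq h a₁ a₂ a₃).E32 =
      qnOp h (S.Wq h a₁ a₂ a₃).H2 := by
  refine S.w_ext fun k i => ?_
  have key := S.rr_ss_interpolate hq i
  have hN := S.qn_succ_ne h hq
  have hR := S.rt_succ_ne h hq
  have hR2 := rt_sq h (S.n + 1)
  have hnu := S.nu_ne h hq
  have he := Complex.exp_ne_zero h
  rw [qnOp_apply_of_eigen h (S.H2_wvec k i), brk_apply]
  -- For each `k` the diagonal coefficient is this same quotient, while the mixed `(m)_1`, `(m)_2`
  -- terms cancel.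
  have key' : qn h (S.m23 + S.m33 + i) =
      (S.ss h i ^ 2 * S.xi h + rr h i ^ 2 * S.eta h) / rt h (S.n + 1) ^ 2 := by
    rw [key, hR2]
    field_simp
  rw [key']
  fin_cases k <;>
    simp only [Fin.zero_eta, Fin.mk_one, Fin.reduceFinMk, E23_0, E23_1, E23_2, E23_3, E32_0,
      E32_1, E32_2, E32_3, map_smul, map_zero, map_add, map_sub, smul_smul, smul_zero] <;>
    rw [← hR2] <;> match_scalars <;> field_simp <;> ring

theorem Wq_sq23 (hq : Generic h) (ha₁ : a₁ ≠ 0) (ha₂ : a₂ ≠ 0) :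
    (S.Wq h a₁ a₂ a₃).E23 * (S.Wq h a₁ a₂ a₃).E23 = 0 := by
  refine S.w_ext fun k i => ?_
  have hR := S.rt_succ_ne h hq
  have hR2 := rt_sq h (S.n + 1)
  have hnu := S.nu_ne h hq
  have he := Complex.exp_ne_zero h
  fin_cases k <;>
    simp only [Fin.zero_eta, Fin.mk_one, Fin.reduceFinMk, Module.End.mul_apply, E23_0, E23_1,
      E23_2, E23_3, map_smul, map_zero, map_sub, smul_smul, smul_zero,
      LinearMap.zero_apply]
  -- Only `(m)_3` is left: its two routes to `(m)_0`, through `(m)_1` and `(m)_2`, carry opposite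
  -- coefficients.
  rw [← hR2]
  match_scalars
  field_simp
  ring

theorem Wq_sq32 (hq : Generic h) (ha₁ : a₁ ≠ 0) (ha₂ : a₂ ≠ 0) :
    (S.Wq h a₁ a₂ a₃).E32 * (S.Wq h a₁ a₂ a₃).E32 = 0 := by
  refine S.w_ext fun k i => ?_
  have hR := S.rt_succ_ne h hq
  have hR2 := rt_sq h (S.n + 1)
  have hnu := S.nu_ne h hq
  fin_cases k <;>
    simp only [Fin.zero_eta, Fin.mk_one, Fin.reduceFinMk, Module.End.mul_apply, E32_0, E32_1,
      E32_2, E32_3, map_smul, map_zero, map_add, smul_smul, smul_zero,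
      LinearMap.zero_apply]
  rw [← hR2]
  match_scalars
  field_simp
  ring

theorem Wq_comm12_32 : brk 1 (S.Wq h a₁ a₂ a₃).E12 (S.Wq h a₁ a₂ a₃).E32 = 0 := by
  refine S.w_ext fun k i => ?_
  rw [brk_apply]
  fin_cases k <;> rcases i with _ | i <;>
    simp only [Fin.zero_eta, Fin.mk_one, Fin.reduceFinMk, E12_zero, E12_0, E12_1, E12_2, E12_3,
      E32_0, E32_1, E32_2, E32_3, map_smul, map_zero, map_add, smul_smul, smul_zero, sub_zero,
      add_zero, LinearMap.zero_apply] <;>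
    match_scalars <;> ring

theorem Wq_comm23_21 : brk 1 (S.Wq h a₁ a₂ a₃).E23 (S.Wq h a₁ a₂ a₃).E21 = 0 := by
  refine S.w_ext fun k i => ?_
  rw [brk_apply]
  fin_cases k <;>
    simp only [Fin.zero_eta, Fin.mk_one, Fin.reduceFinMk, E21_0, E21_1, E21_2, E21_3,
      E23_0, E23_1, E23_2, E23_3, map_smul, map_zero, map_sub, smul_smul, smul_zero, sub_zero,
      LinearMap.zero_apply] <;>
    match_scalars <;> ring

/-- The relation reads `E₁₂² E₂₃ - (q + q⁻¹) E₁₂ E₂₃ E₁₂ + E₂₃ E₁₂² = 0`. Since `E₂₃` keeps `i`,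
each term vanishes for `i ≤ 1`; for larger `i` the coefficients contain the three-term recursion of
`rr` or `ss`. -/
theorem Wq_serre12 :
    brk (Complex.exp h) (S.Wq h a₁ a₂ a₃).E12 ((S.Wq h a₁ a₂ a₃).E13 h) = 0 := by
  refine S.w_ext fun k i => ?_
  have he := Complex.exp_ne_zero h
  rw [brk_apply, Ops.E13, brk_apply, brk_apply]
  rcases i with _ | _ | i
  · fin_cases k <;>
      simp [E12_zero, E23_0, E23_1, E23_2, E23_3]
  · fin_cases k <;>
      simp [E12_zero, E12_0, E12_1, E12_2, E12_3, E23_0, E23_1, E23_2, E23_3]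
  · have hr := rr_three_term (h := h) i
    have hs := S.ss_three_term (h := h) i
    have e1 : Complex.exp h * (Complex.exp h)⁻¹ = 1 := mul_inv_cancel₀ he
    fin_cases k <;>
      simp only [Fin.zero_eta, Fin.mk_one, Fin.reduceFinMk, E12_0, E12_1, E12_2, E12_3,
        E23_0, E23_1, E23_2, E23_3, map_smul, map_zero, map_sub, smul_smul, smul_zero, sub_zero,
        LinearMap.zero_apply] <;>
      match_scalars
    · linear_combination (a₁ / rt h (S.n + 1) * S.xi h * rr h (i + 2) * rr h (i + 1) * S.ss h (i + 1)) * hs +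
        (a₁ / rt h (S.n + 1) * S.xi h * rr h (i + 2) * rr h (i + 1) * S.ss h (i + 1)) * S.ss h i ^ 2 * e1
    · linear_combination (a₂ / S.nu h * S.eta h * rr h (i + 1) * S.ss h (i + 2) * S.ss h (i + 1)) * hr +
        (a₂ / S.nu h * S.eta h * rr h (i + 1) * S.ss h (i + 2) * S.ss h (i + 1)) * rr h i ^ 2 * e1
    · linear_combination (a₃ / (a₁ * Complex.exp h * rt h (S.n + 1)) * S.eta h * rr h (i + 1) * S.ss h (i + 1) *
        S.ss h i) * hr +
        (a₃ / (a₁ * Complex.exp h * rt h (S.n + 1)) * S.eta h * rr h (i + 1) * S.ss h (i + 1) *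
        S.ss h i) * rr h i ^ 2 * e1
    · linear_combination (-(a₃ / (a₂ * Complex.exp h * qn h (S.n + 1)) * S.nu h * S.xi h) * rr h (i + 1) * rr h i *
        S.ss h (i + 1)) * hs +
        (-(a₃ / (a₂ * Complex.exp h * qn h (S.n + 1)) * S.nu h * S.xi h) * rr h (i + 1) * rr h i *
        S.ss h (i + 1)) * S.ss h i ^ 2 * e1

/-- The same recursion is used; `E₂₁` raises `i`, so small `i` need no separate treatment. -/
theorem Wq_serre21 :
    brk (Complex.exp h) (S.Wq h a₁ a₂ a₃).E21 ((S.Wq h a₁ a₂ a₃).E31 h) = 0 := by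
  refine S.w_ext fun k i => ?_
  have he := Complex.exp_ne_zero h
  rw [brk_apply, Ops.E31, LinearMap.neg_apply, LinearMap.neg_apply, brk_apply, brk_apply]
  have hr := rr_three_term (h := h) i
  have hs := S.ss_three_term (h := h) i
  have e1 : Complex.exp h * (Complex.exp h)⁻¹ = 1 := mul_inv_cancel₀ he
  fin_cases k <;>
    simp only [Fin.zero_eta, Fin.mk_one, Fin.reduceFinMk, E21_0, E21_1, E21_2, E21_3,
      E32_0, E32_1, E32_2, E32_3, map_smul, map_zero, map_sub, map_add, map_neg, smul_smul,
      smul_zero, sub_zero, LinearMap.zero_apply] <;>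
    match_scalars
  · linear_combination (-(1 / (a₁ * rt h (S.n + 1))) * rr h (i + 1) * rr h (i + 2) * S.ss h (i + 1)) * hs +
      (-(1 / (a₁ * rt h (S.n + 1))) * rr h (i + 1) * rr h (i + 2) * S.ss h (i + 1)) * S.ss h (i + 2) ^ 2 * e1
  · linear_combination (-(1 / (a₂ * qn h (S.n + 1)) * S.nu h) * rr h (i + 1) * S.ss h (i + 1) * S.ss h (i + 2)) * hr +
      (-(1 / (a₂ * qn h (S.n + 1)) * S.nu h) * rr h (i + 1) * S.ss h (i + 1) * S.ss h (i + 2)) * rr h (i + 2) ^ 2 * e1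
  · linear_combination (-(a₁ * Complex.exp h / (a₃ * rt h (S.n + 1))) * S.ss h i * S.ss h (i + 1) * rr h (i + 1)) * hr +
      (-(a₁ * Complex.exp h / (a₃ * rt h (S.n + 1))) * S.ss h i * S.ss h (i + 1) * rr h (i + 1)) * rr h (i + 2) ^ 2 * e1
  · linear_combination ((a₂ * Complex.exp h / (a₃ * S.nu h)) * rr h i * rr h (i + 1) * S.ss h (i + 1)) * hs +
      ((a₂ * Complex.exp h / (a₃ * S.nu h)) * rr h i * rr h (i + 1) * S.ss h (i + 1)) * S.ss h (i + 2) ^ 2 * e1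

set_option linter.unusedSimpArgs false in
theorem Wq_isRep (hq : Generic h) (ha₁ : a₁ ≠ 0) (ha₂ : a₂ ≠ 0) (ha₃ : a₃ ≠ 0) :
    (S.Wq h a₁ a₂ a₃).IsRep h where
  cartan12 := by
    refine S.w_ext fun k i => ?_
    simp only [brk_apply, E11_wvec, E22_wvec, map_smul, LinearMap.zero_apply]
    module
  cartan13 := by
    refine S.w_ext fun k i => ?_
    simp only [brk_apply, E11_wvec, E33_wvec, map_smul, LinearMap.zero_apply]
    module
  cartan23 := by
    refine S.w_ext fun k i => ?_
    simp only [brk_apply, E22_wvec, E33_wvec, map_smul, LinearMap.zero_apply]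
    module
  wt11_12 := by
    refine S.w_ext fun k i => ?_
    rcases i with _ | i
    · simp [brk_apply, E11_wvec, E12_zero]
    · simp only [brk_apply, E11_wvec, E12_wvec, map_smul, smul_smul, Nat.add_sub_cancel, m11,
        LinearMap.neg_apply, LinearMap.zero_apply]
      push_cast
      module
  wt11_21 := by
    refine S.w_ext fun k i => ?_
    simp only [brk_apply, E11_wvec, E21_wvec, map_smul, smul_smul, m11, LinearMap.neg_apply,
      LinearMap.zero_apply]
    push_cast
    module
  wt11_23 := by
    refine S.w_ext fun k i => ?_
    fin_cases k <;>
      simp only [Fin.zero_eta, Fin.mk_one, Fin.reduceFinMk, brk_apply, E11_wvec, E23_0, E23_1,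
        E23_2, E23_3, map_smul, map_sub, map_zero, smul_smul, m11, m12, m22, m32, top, bot,
        Matrix.cons_val, LinearMap.neg_apply, LinearMap.zero_apply] <;>
      module
  wt11_32 := by
    refine S.w_ext fun k i => ?_
    fin_cases k <;>
      simp only [Fin.zero_eta, Fin.mk_one, Fin.reduceFinMk, brk_apply, E11_wvec, E32_0, E32_1,
        E32_2, E32_3, map_smul, map_add, map_zero, smul_smul, m11, m12, m22, m32, top, bot,
        Matrix.cons_val, LinearMap.neg_apply, LinearMap.zero_apply] <;>
      module
  wt22_12 := by
    refine S.w_ext fun k i => ?_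
    rcases i with _ | i
    · simp [brk_apply, E22_wvec, E12_zero]
    · simp only [brk_apply, E22_wvec, E12_wvec, map_smul, smul_smul, Nat.add_sub_cancel, m11,
        LinearMap.neg_apply, LinearMap.zero_apply]
      push_cast
      module
  wt22_21 := by
    refine S.w_ext fun k i => ?_
    simp only [brk_apply, E22_wvec, E21_wvec, map_smul, smul_smul, m11, LinearMap.neg_apply,
      LinearMap.zero_apply]
    push_cast
    module
  wt22_23 := by
    refine S.w_ext fun k i => ?_
    fin_cases k <;>
      simp only [Fin.zero_eta, Fin.mk_one, Fin.reduceFinMk, brk_apply, E22_wvec, E23_0, E23_1,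
        E23_2, E23_3, map_smul, map_sub, map_zero, smul_smul, m11, m12, m22, m32, top, bot,
        Matrix.cons_val, LinearMap.neg_apply, LinearMap.zero_apply] <;>
      push_cast <;> module
  wt22_32 := by
    refine S.w_ext fun k i => ?_
    fin_cases k <;>
      simp only [Fin.zero_eta, Fin.mk_one, Fin.reduceFinMk, brk_apply, E22_wvec, E32_0, E32_1,
        E32_2, E32_3, map_smul, map_add, map_zero, smul_smul, m11, m12, m22, m32, top, bot,
        Matrix.cons_val, LinearMap.neg_apply, LinearMap.zero_apply] <;>
      push_cast <;> module
  wt33_12 := by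
    refine S.w_ext fun k i => ?_
    rcases i with _ | i
    · simp [brk_apply, E33_wvec, E12_zero]
    · simp only [brk_apply, E33_wvec, E12_wvec, map_smul, smul_smul, Nat.add_sub_cancel, m11,
        LinearMap.neg_apply, LinearMap.zero_apply]
      push_cast
      module
  wt33_21 := by
    refine S.w_ext fun k i => ?_
    simp only [brk_apply, E33_wvec, E21_wvec, map_smul, smul_smul, m11, LinearMap.neg_apply,
      LinearMap.zero_apply]
    module
  wt33_23 := by
    refine S.w_ext fun k i => ?_
    fin_cases k <;>
      simp only [Fin.zero_eta, Fin.mk_one, Fin.reduceFinMk, brk_apply, E33_wvec, E23_0, E23_1,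
        E23_2, E23_3, map_smul, map_sub, map_zero, smul_smul, m11, m12, m22, m32, top, bot,
        Matrix.cons_val, LinearMap.neg_apply, LinearMap.zero_apply] <;>
      push_cast <;> module
  wt33_32 := by
    refine S.w_ext fun k i => ?_
    fin_cases k <;>
      simp only [Fin.zero_eta, Fin.mk_one, Fin.reduceFinMk, brk_apply, E33_wvec, E32_0, E32_1,
        E32_2, E32_3, map_smul, map_add, map_zero, smul_smul, m11, m12, m22, m32, top, bot,
        Matrix.cons_val, LinearMap.neg_apply, LinearMap.zero_apply] <;>
      push_cast <;> module
  comm12_21 := S.Wq_comm12_21 hq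
  anticomm23_32 := S.Wq_anticomm23_32 hq ha₁ ha₂ ha₃
  comm12_32 := S.Wq_comm12_32
  comm23_21 := S.Wq_comm23_21
  sq23 := S.Wq_sq23 hq ha₁ ha₂
  sq32 := S.Wq_sq32 hq ha₁ ha₂
  serre12 := S.Wq_serre12
  serre21 := S.Wq_serre21

end Signature

/-! ### Submodules generated by an even submodule annihilated by `E₂₃` -/

section EvenSubmodule

variable {U : Type*} [AddCommGroup U] [Module ℂ U] {h : ℂ} {ρ : Ops U}

/-- A subspace stable under the even generators and annihilated by `E₂₃`. -/
structure Primitive (ρ : Ops U) (X : Submodule ℂ U) : Prop where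
  E11 : ∀ x ∈ X, ρ.E11 x ∈ X
  E22 : ∀ x ∈ X, ρ.E22 x ∈ X
  E33 : ∀ x ∈ X, ρ.E33 x ∈ X
  E12 : ∀ x ∈ X, ρ.E12 x ∈ X
  E21 : ∀ x ∈ X, ρ.E21 x ∈ X
  E23 : ∀ x ∈ X, ρ.E23 x = 0

/-- The subspace `X + E₃₂ X + E₃₁ X + E₃₂ E₃₁ X`. -/
noncomputable def generated (h : ℂ) (ρ : Ops U) (X : Submodule ℂ U) : Submodule ℂ U :=
  (X ⊔ X.map ρ.E32) ⊔ (X.map (ρ.E31 h) ⊔ X.map (ρ.E32 * ρ.E31 h))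

theorem generated_le {X N : Submodule ℂ U} (h0 : ∀ x ∈ X, x ∈ N) (h1 : ∀ x ∈ X, ρ.E32 x ∈ N)
    (h2 : ∀ x ∈ X, ρ.E31 h x ∈ N) (h3 : ∀ x ∈ X, ρ.E32 (ρ.E31 h x) ∈ N) :
    generated h ρ X ≤ N :=
  sup_le (sup_le h0 (Submodule.map_le_iff_le_comap.2 h1))
    (sup_le (Submodule.map_le_iff_le_comap.2 h2) (Submodule.map_le_iff_le_comap.2 h3))

theorem mem_generated {X : Submodule ℂ U} {x : U} (hx : x ∈ X) : x ∈ generated h ρ X :=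
  Submodule.mem_sup_left (Submodule.mem_sup_left hx)

theorem E32_mem_generated {X : Submodule ℂ U} {x : U} (hx : x ∈ X) :
    ρ.E32 x ∈ generated h ρ X :=
  Submodule.mem_sup_left (Submodule.mem_sup_right (Submodule.mem_map_of_mem hx))

theorem E31_mem_generated {X : Submodule ℂ U} {x : U} (hx : x ∈ X) :
    ρ.E31 h x ∈ generated h ρ X :=
  Submodule.mem_sup_right (Submodule.mem_sup_left (Submodule.mem_map_of_mem hx))

theorem E32_E31_mem_generated {X : Submodule ℂ U} {x : U} (hx : x ∈ X) :
    ρ.E32 (ρ.E31 h x) ∈ generated h ρ X :=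
  Submodule.mem_sup_right (Submodule.mem_sup_right
    (Submodule.mem_map_of_mem (f := ρ.E32 * ρ.E31 h) hx))

theorem finrank_generated_le [FiniteDimensional ℂ U] (X : Submodule ℂ U) :
    Module.finrank ℂ (generated h ρ X) ≤ 4 * Module.finrank ℂ X := by
  have h1 := Submodule.finrank_add_le_finrank_add_finrank (X ⊔ X.map ρ.E32)
    (X.map (ρ.E31 h) ⊔ X.map (ρ.E32 * ρ.E31 h))
  have h2 := Submodule.finrank_add_le_finrank_add_finrank X (X.map ρ.E32)
  have h3 := Submodule.finrank_add_le_finrank_add_finrank (X.map (ρ.E31 h))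
    (X.map (ρ.E32 * ρ.E31 h))
  have h4 := Submodule.finrank_map_le ρ.E32 X
  have h5 := Submodule.finrank_map_le (ρ.E31 h) X
  have h6 := Submodule.finrank_map_le (ρ.E32 * ρ.E31 h) X
  rw [generated]
  omega

theorem brk_eq_iff {r : ℂ} {A B C : Module.End ℂ U} :
    brk r A B = C ↔ ∀ v, A (B v) = C v + r • B (A v) := by
  rw [LinearMap.ext_iff]
  exact forall_congr' fun v => sub_eq_iff_eq_add

theorem E31_apply (v : U) : ρ.E31 h v = (Complex.exp h)⁻¹ • ρ.E32 (ρ.E21 v) -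
    ρ.E21 (ρ.E32 v) := by
  simp [Ops.E31, brk]

variable [FiniteDimensional ℂ U]

namespace Ops.IsRep

theorem wt11_31 (hρ : ρ.IsRep h) (v : U) :
    ρ.E11 (ρ.E31 h v) = ρ.E31 h (ρ.E11 v) - ρ.E31 h v := by
  have h1 := brk_eq_iff.1 hρ.wt11_21
  have h2 := brk_eq_iff.1 hρ.wt11_32
  simp only [E31_apply, map_sub, map_smul, h1, h2, map_add, LinearMap.neg_apply,
    LinearMap.zero_apply, map_zero, map_neg, one_smul]
  module

theorem wt22_31 (hρ : ρ.IsRep h) (v : U) :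
    ρ.E22 (ρ.E31 h v) = ρ.E31 h (ρ.E22 v) := by
  have h1 := brk_eq_iff.1 hρ.wt22_21
  have h2 := brk_eq_iff.1 hρ.wt22_32
  simp only [E31_apply, map_sub, map_smul, h1, h2, map_add, LinearMap.neg_apply,
    map_neg, one_smul]
  module

theorem wt33_31 (hρ : ρ.IsRep h) (v : U) :
    ρ.E33 (ρ.E31 h v) = ρ.E31 h (ρ.E33 v) + ρ.E31 h v := by
  have h1 := brk_eq_iff.1 hρ.wt33_21
  have h2 := brk_eq_iff.1 hρ.wt33_32
  simp only [E31_apply, map_sub, map_smul, h1, h2, map_add, LinearMap.zero_apply,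
    map_zero, one_smul]
  module

theorem E21_E31 (hρ : ρ.IsRep h) (v : U) :
    ρ.E21 (ρ.E31 h v) = Complex.exp h • ρ.E31 h (ρ.E21 v) := by
  simpa using brk_eq_iff.1 hρ.serre21 v

theorem E32_E32 (hρ : ρ.IsRep h) (v : U) : ρ.E32 (ρ.E32 v) = 0 :=
  LinearMap.congr_fun hρ.sq32 v

/-- The Serre relation, applied to `E₃₂ v` and then to `v` followed by `E₃₂`, expresses `E₃₂ E₂₁²
E₃₂ v` as `q + q⁻¹` times each of `E₂₁ E₃₂ E₂₁ E₃₂ v` and `E₃₂ E₂₁ E₃₂ E₂₁ v`. As `q + q⁻¹ ≠ 0`,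
these agree, and then the three terms of `E₃₁² v` cancel. -/
theorem E31_E31 (hq : Generic h) (hρ : ρ.IsRep h) (v : U) : ρ.E31 h (ρ.E31 h v) = 0 := by
  have he := Complex.exp_ne_zero h
  have hc := hq.exp_add_inv_ne
  have s1 := hρ.E21_E31 (ρ.E32 v)
  have s2 := congrArg ρ.E32 (hρ.E21_E31 v)
  simp only [E31_apply, map_sub, map_smul, hρ.E32_E32, map_zero, smul_zero, zero_sub, sub_zero]
    at s1 s2 ⊢
  set z1 := ρ.E21 (ρ.E32 (ρ.E21 (ρ.E32 v)))
  set z2 := ρ.E32 (ρ.E21 (ρ.E32 (ρ.E21 v)))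
  set z3 := ρ.E32 (ρ.E21 (ρ.E21 (ρ.E32 v)))
  set q := Complex.exp h
  have e1 : z3 = (q + q⁻¹) • z1 := by
    rw [smul_sub, smul_smul, mul_inv_cancel₀ he, one_smul] at s1
    rw [add_smul, s1]
    abel
  have e2 : z3 = (q + q⁻¹) • z2 := by
    rw [smul_neg] at s2
    rw [add_smul, ← sub_eq_zero, ← neg_eq_zero]
    rw [← sub_eq_zero] at s2
    rw [← s2]
    abel
  have e3 : z1 = z2 := smul_right_injective U hc (e1.symm.trans e2)
  rw [e2, e3]
  have : q⁻¹ * q = 1 := inv_mul_cancel₀ he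
  match_scalars
  linear_combination -this

theorem E12_E31 (hρ : ρ.IsRep h) (v : U) : ρ.E12 (ρ.E31 h v) = ρ.E31 h (ρ.E12 v) -
    qnOp h ρ.H1 (ρ.E32 v) + (Complex.exp h)⁻¹ • ρ.E32 (qnOp h ρ.H1 v) := by
  have h1 := brk_eq_iff.1 hρ.comm12_21
  have h2 := brk_eq_iff.1 hρ.comm12_32
  simp only [E31_apply, map_sub, map_smul, h1, h2, map_add, LinearMap.zero_apply, zero_add,
    one_smul]
  module

theorem E23_E32 (hρ : ρ.IsRep h) (v : U) :
    ρ.E23 (ρ.E32 v) = qnOp h ρ.H2 v - ρ.E32 (ρ.E23 v) := by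
  rw [brk_eq_iff.1 hρ.anticomm23_32, neg_one_smul, sub_eq_add_neg]

end Ops.IsRep

/-- Straightening: every generator can be moved to the right past `E₃₂` and `E₃₁` until it acts on
`X`, and the squares `E₃₂²`, `E₃₁²` vanish, so no words beyond the four summands arise. -/
theorem Primitive.invariant_generated (hq : Generic h) (hρ : ρ.IsRep h) {X : Submodule ℂ U}
    (hX : Primitive ρ X) : ρ.Invariant (generated h ρ X) := by
  have hH1 : ∀ x ∈ X, qnOp h ρ.H1 x ∈ X :=
    qnOp_mem (fun x hx => X.sub_mem (hX.E11 x hx) (hX.E22 x hx)) h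
  have hH2 : ∀ x ∈ X, qnOp h ρ.H2 x ∈ X :=
    qnOp_mem (fun x hx => X.add_mem (hX.E22 x hx) (hX.E33 x hx)) h
  have wt11_32 := brk_eq_iff.1 hρ.wt11_32
  have wt22_32 := brk_eq_iff.1 hρ.wt22_32
  have wt33_32 := brk_eq_iff.1 hρ.wt33_32
  have h1232 := brk_eq_iff.1 hρ.comm12_32
  have h2321 := brk_eq_iff.1 hρ.comm23_21
  simp only [LinearMap.zero_apply, zero_add, one_smul] at wt11_32 wt33_32 h1232 h2321
  simp only [one_smul, LinearMap.neg_apply] at wt22_32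
  -- From `H₁ E₃₂ = E₃₂ (H₁ + 1)` the subspace `E₃₂ X` is stable under `H₁`, hence under `[H₁]`.
  have hH1' : ∀ x ∈ X, ∃ y ∈ X, ρ.E32 y = qnOp h ρ.H1 (ρ.E32 x) := by
    intro x hx
    refine qnOp_mem (N := X.map ρ.E32) ?_ h _ (Submodule.mem_map_of_mem hx)
    rintro _ ⟨y, hy, rfl⟩
    refine ⟨ρ.E11 y - ρ.E22 y + y, X.add_mem (X.sub_mem (hX.E11 y hy) (hX.E22 y hy)) hy, ?_⟩
    rw [Ops.H1, LinearMap.sub_apply, wt11_32, wt22_32, map_add, map_sub]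
    abel
  -- Likewise `H₂ E₃₁ = E₃₁ (H₂ + 1)`.
  have hH2' : ∀ x ∈ X, ∃ y ∈ X, ρ.E31 h y = qnOp h ρ.H2 (ρ.E31 h x) := by
    intro x hx
    refine qnOp_mem (N := X.map (ρ.E31 h)) ?_ h _ (Submodule.mem_map_of_mem hx)
    rintro _ ⟨y, hy, rfl⟩
    refine ⟨ρ.E22 y + ρ.E33 y + y, X.add_mem (X.add_mem (hX.E22 y hy) (hX.E33 y hy)) hy, ?_⟩
    rw [Ops.H2, LinearMap.add_apply, hρ.wt22_31, hρ.wt33_31, map_add, map_add]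
    abel
  have h2331 : ∀ x ∈ X, ρ.E23 (ρ.E31 h x) ∈ X := by
    intro x hx
    rw [E31_apply, map_sub, map_smul, h2321, hρ.E23_E32, hρ.E23_E32, hX.E23 _ (hX.E21 x hx),
      hX.E23 x hx, map_zero, sub_zero, sub_zero]
    exact X.sub_mem (X.smul_mem _ (hH2 _ (hX.E21 x hx))) (hX.E21 _ (hH2 x hx))
  have m0 : ∀ {x : U}, x ∈ X → x ∈ generated h ρ X := mem_generated
  have m1 : ∀ {x : U}, x ∈ X → ρ.E32 x ∈ generated h ρ X := E32_mem_generated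
  have m2 : ∀ {x : U}, x ∈ X → ρ.E31 h x ∈ generated h ρ X := E31_mem_generated
  have m3 : ∀ {x : U}, x ∈ X → ρ.E32 (ρ.E31 h x) ∈ generated h ρ X := E32_E31_mem_generated
  set Y := generated h ρ X
  constructor
  · refine generated_le (fun x hx => m0 (hX.E11 x hx)) (fun x hx => ?_) (fun x hx => ?_)
      fun x hx => ?_ <;> rw [Submodule.mem_comap]
    · rw [wt11_32]
      exact m1 (hX.E11 x hx)
    · rw [hρ.wt11_31]
      exact Y.sub_mem (m2 (hX.E11 x hx)) (m2 hx)
    · rw [wt11_32, hρ.wt11_31, map_sub]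
      exact Y.sub_mem (m3 (hX.E11 x hx)) (m3 hx)
  · refine generated_le (fun x hx => m0 (hX.E22 x hx)) (fun x hx => ?_) (fun x hx => ?_)
      fun x hx => ?_ <;> rw [Submodule.mem_comap]
    · rw [wt22_32]
      exact Y.add_mem (Y.neg_mem (m1 hx)) (m1 (hX.E22 x hx))
    · rw [hρ.wt22_31]
      exact m2 (hX.E22 x hx)
    · rw [wt22_32, hρ.wt22_31]
      exact Y.add_mem (Y.neg_mem (m3 hx)) (m3 (hX.E22 x hx))
  · refine generated_le (fun x hx => m0 (hX.E33 x hx)) (fun x hx => ?_) (fun x hx => ?_)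
      fun x hx => ?_ <;> rw [Submodule.mem_comap]
    · rw [wt33_32]
      exact Y.add_mem (m1 hx) (m1 (hX.E33 x hx))
    · rw [hρ.wt33_31]
      exact Y.add_mem (m2 (hX.E33 x hx)) (m2 hx)
    · rw [wt33_32, hρ.wt33_31, map_add]
      exact Y.add_mem (m3 hx) (Y.add_mem (m3 (hX.E33 x hx)) (m3 hx))
  · refine generated_le (fun x hx => m0 (hX.E12 x hx)) (fun x hx => ?_) (fun x hx => ?_)
      fun x hx => ?_ <;> rw [Submodule.mem_comap]
    · rw [h1232]
      exact m1 (hX.E12 x hx)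
    · obtain ⟨y, hy, e⟩ := hH1' x hx
      rw [hρ.E12_E31, ← e]
      exact Y.add_mem (Y.sub_mem (m2 (hX.E12 x hx)) (m1 hy)) (Y.smul_mem _ (m1 (hH1 x hx)))
    · obtain ⟨y, hy, e⟩ := hH1' x hx
      rw [h1232, hρ.E12_E31, ← e, map_add, map_sub, map_smul, hρ.E32_E32, hρ.E32_E32, smul_zero,
        sub_zero, add_zero]
      exact m3 (hX.E12 x hx)
  · have h2132 : ∀ v, ρ.E21 (ρ.E32 v) = (Complex.exp h)⁻¹ • ρ.E32 (ρ.E21 v) - ρ.E31 h v :=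
      fun v => by rw [E31_apply, sub_sub_cancel]
    refine generated_le (fun x hx => m0 (hX.E21 x hx)) (fun x hx => ?_) (fun x hx => ?_)
      fun x hx => ?_ <;> rw [Submodule.mem_comap]
    · rw [h2132]
      exact Y.sub_mem (Y.smul_mem _ (m1 (hX.E21 x hx))) (m2 hx)
    · rw [hρ.E21_E31]
      exact Y.smul_mem _ (m2 (hX.E21 x hx))
    · rw [h2132, hρ.E31_E31 hq, sub_zero, hρ.E21_E31, map_smul]
      exact Y.smul_mem _ (Y.smul_mem _ (m3 (hX.E21 x hx)))
  · refine generated_le (fun x hx => ?_) (fun x hx => ?_) (fun x hx => m0 (h2331 x hx))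
      fun x hx => ?_ <;> rw [Submodule.mem_comap]
    · rw [hX.E23 x hx]
      exact Y.zero_mem
    · rw [hρ.E23_E32, hX.E23 x hx, map_zero, sub_zero]
      exact m0 (hH2 x hx)
    · obtain ⟨y, hy, e⟩ := hH2' x hx
      rw [hρ.E23_E32, ← e]
      exact Y.sub_mem (m2 hy) (m1 (h2331 x hx))
  · refine generated_le (fun x hx => m1 hx) (fun x hx => ?_) (fun x hx => m3 hx)
      fun x hx => ?_ <;> rw [Submodule.mem_comap, hρ.E32_E32] <;> exact Y.zero_mem

end EvenSubmodule

/-! ### `W^q([m])` is induced from `V^q([m])` -/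

namespace Signature

variable (S : Signature) {h a₁ a₂ a₃ : ℂ}

theorem eq_top_of_wvec_mem {N : Submodule ℂ S.WSpace} (hN : ∀ k i, S.wvec k i ∈ N) : N = ⊤ := by
  rw [eq_top_iff, ← (Pi.basisFun ℂ (Label S.n)).span_eq, Submodule.span_le]
  rintro _ ⟨p, rfl⟩
  rw [Pi.basisFun_apply, ← wvec_label]
  exact hN _ _

/-- Only `E₂₁` and `E₃₂` are needed, and their coefficients do not involve `ξ` or `η`. `E₂₁` sweeps
out `V_0^q`; `E₃₂` of the highest vector is a multiple of the top of `V_1^q`; then `V_2^q` and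
`V_3^q` come from `E₃₂` on `V_0^q` and `V_1^q`. -/
theorem eq_top_of_highest_mem (hq : Generic h) (ha₁ : a₁ ≠ 0) (ha₂ : a₂ ≠ 0) (ha₃ : a₃ ≠ 0)
    {N : Submodule ℂ S.WSpace} (hN : (S.Wq h a₁ a₂ a₃).Invariant N) (h0 : S.wvec 0 0 ∈ N) :
    N = ⊤ := by
  have hR := S.rt_succ_ne h hq
  have hQ := S.qn_succ_ne h hq
  have hnu := S.nu_ne h hq
  have he := Complex.exp_ne_zero h
  have hv0 : ∀ i, S.wvec 0 i ∈ N := by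
    intro i
    induction i with
    | zero => exact h0
    | succ i ih =>
      by_cases hi : i + 1 ≤ S.n
      · have := hN.E21 ih
        rw [Submodule.mem_comap, E21_0] at this
        exact (N.smul_mem_iff (mul_ne_zero (rr_ne h hq (by omega)) (S.ss_ne h hq hi))).1 this
      · rw [S.wvec_eq_zero (by simp [top, bot]; omega)]
        exact N.zero_mem
  have hv1 : ∀ i, S.wvec 1 i ∈ N := by
    intro i
    induction i with
    | zero =>
      have := hN.E32 h0
      rw [Submodule.mem_comap, E32_0, rr_zero, mul_zero, zero_smul, add_zero] at this
      exact (N.smul_mem_iff (mul_ne_zero (one_div_ne_zero (mul_ne_zero ha₁ hR))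
        (S.ss_ne h hq (Nat.zero_le _)))).1 this
    | succ i ih =>
      by_cases hi : i ≤ S.n
      · have := hN.E21 ih
        rw [Submodule.mem_comap, E21_1] at this
        exact (N.smul_mem_iff (mul_ne_zero (rr_ne h hq (by omega)) (S.ss_ne h hq hi))).1 this
      · rw [S.wvec_eq_zero (by simp [top, bot]; omega)]
        exact N.zero_mem
  refine S.eq_top_of_wvec_mem fun k i => ?_
  fin_cases k
  · exact hv0 i
  · exact hv1 i
  · by_cases hi : i = 0
    · change S.wvec 2 i ∈ N
      rw [S.wvec_eq_zero (by simp [top, bot]; omega)]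
      exact N.zero_mem
    · have := hN.E32 (hv0 i)
      rw [Submodule.mem_comap, E32_0, Submodule.add_mem_iff_right _ (N.smul_mem _ (hv1 i))]
        at this
      exact (N.smul_mem_iff (mul_ne_zero (mul_ne_zero (one_div_ne_zero (mul_ne_zero ha₂ hQ)) hnu)
        (rr_ne h hq hi))).1 this
  · by_cases hi : i = 0
    · change S.wvec 3 i ∈ N
      rw [S.wvec_eq_zero (by simp [top, bot]; omega)]
      exact N.zero_mem
    · have := hN.E32 (hv1 i)
      rw [Submodule.mem_comap, E32_1] at this
      exact (N.smul_mem_iff (mul_ne_zero (div_ne_zero (mul_ne_zero ha₁ he) (mul_ne_zero ha₃ hR))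
        (rr_ne h hq hi))).1 this

theorem card_label_ge : 4 * (S.n + 1) ≤ Fintype.card (Label S.n) := by
  -- The four pieces have `n + 1`, `n + 2`, `n`, `n + 1` labels, so the last index of the short
  -- piece `k = 2` is sent to the extra label of `k = 1`.
  let φ : Fin 4 × Fin (S.n + 1) → ℕ × ℕ := fun p =>
    if p.1 = 2 then (if (p.2 : ℕ) < S.n then (2, p.2 + 1) else (1, S.n + 1))
    else (p.1, p.2 + top p.1)
  have hφ : ∀ p, ∃ l : Label S.n, ((l.1.1 : ℕ), (l.1.2 : ℕ)) = φ p := by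
    rintro ⟨k, i, hi⟩
    fin_cases k
    · exact ⟨⟨(0, ⟨i, by omega⟩), by simp [top, bot]; omega⟩, by simp [φ, top]⟩
    · exact ⟨⟨(1, ⟨i, by omega⟩), by simp [top, bot]; omega⟩, by simp [φ, top]⟩
    · by_cases hi' : i < S.n
      · exact ⟨⟨(2, ⟨i + 1, by omega⟩), by simp [top, bot]; omega⟩, by simp [φ, hi']⟩
      · exact ⟨⟨(1, ⟨S.n + 1, by omega⟩), by simp [top, bot]⟩, by simp [φ, hi']⟩
    · exact ⟨⟨(3, ⟨i + 1, by omega⟩), by simp [top, bot]; omega⟩, by simp [φ, top]⟩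
  choose ψ hψ using hφ
  have hinj : Function.Injective ψ := by
    intro p p' e
    have e' : φ p = φ p' := by rw [← hψ, ← hψ, e]
    obtain ⟨k, i, hi⟩ := p
    obtain ⟨k', i', hi'⟩ := p'
    fin_cases k <;> fin_cases k' <;>
      simp [φ, top, Prod.ext_iff] at e' ⊢ <;> (try split_ifs at e') <;> (try simp at e' ⊢) <;> omega
  have := Fintype.card_le_of_injective ψ hinj
  simpa using this

theorem vvec_eq_zero {i : ℕ} (hi : ¬i ≤ S.n) : S.vvec i = 0 := by
  funext p
  have := p.2
  simp only [vvec, Pi.zero_apply, ite_eq_right_iff, one_ne_zero, imp_false]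
  omega

theorem vvec_eq_single {i : ℕ} (hi : i ≤ S.n) :
    S.vvec i = Pi.single (⟨i, by omega⟩ : Fin (S.n + 1)) 1 := by
  funext p
  simp [vvec, Pi.single_apply, Fin.ext_iff]

theorem vOp_vvec {X : Type*} [AddCommGroup X] [Module ℂ X] (F : ℕ → X) {i : ℕ} (hi : i ≤ S.n) :
    S.vOp F (S.vvec i) = F i := by
  rw [S.vvec_eq_single hi, ← Pi.basisFun_apply, vOp, Module.Basis.constr_basis]

theorem v_ext {X : Type*} [AddCommGroup X] [Module ℂ X] {A B : S.VSpace →ₗ[ℂ] X}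
    (hAB : ∀ i ≤ S.n, A (S.vvec i) = B (S.vvec i)) : A = B := by
  refine (Pi.basisFun ℂ (Fin (S.n + 1))).ext fun p => ?_
  have hp : (p : ℕ) ≤ S.n := by omega
  rw [Pi.basisFun_apply]
  have := hAB p hp
  rwa [S.vvec_eq_single hp] at this

theorem sem_of_vvec {X : Type*} [AddCommGroup X] [Module ℂ X] {f : S.VSpace →ₗ[ℂ] X}
    {A : Module.End ℂ S.VSpace} {B : Module.End ℂ X}
    (hf : ∀ i ≤ S.n, f (A (S.vvec i)) = B (f (S.vvec i))) : Sem f A B :=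
  LinearMap.congr_fun (S.v_ext (A := f ∘ₗ A) (B := B ∘ₗ f) hf)

theorem incl_vvec (i : ℕ) : S.incl (S.vvec i) = S.wvec 0 i := by
  by_cases hi : i ≤ S.n
  · exact S.vOp_vvec _ hi
  · rw [S.vvec_eq_zero hi, S.wvec_eq_zero (by simpa [top, bot] using hi), map_zero]

theorem incl_evenIntertwines : EvenIntertwines (S.Vq h) (S.Wq h a₁ a₂ a₃).toEvenOps S.incl where
  E11 := S.sem_of_vvec fun i hi => by
    rw [Vq, S.vOp_vvec _ hi, map_smul, incl_vvec, E11_wvec]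
  E22 := S.sem_of_vvec fun i hi => by
    rw [Vq, S.vOp_vvec _ hi, map_smul, incl_vvec, E22_wvec]
    simp [m12, m22, top, bot]
  E33 := S.sem_of_vvec fun i hi => by
    rw [Vq, S.vOp_vvec _ hi, map_smul, incl_vvec, E33_wvec]
    simp [m32, top, bot]
  E12 := S.sem_of_vvec fun i hi => by
    rw [Vq, S.vOp_vvec _ hi, map_smul, incl_vvec, incl_vvec, E12_wvec]
    simp [m12, m22, top, bot]
  E21 := S.sem_of_vvec fun i hi => by
    rw [Vq, S.vOp_vvec _ hi, map_smul, incl_vvec, incl_vvec, E21_wvec]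
    simp [m12, m22, top, bot]

theorem E23_incl (v : S.VSpace) : (S.Wq h a₁ a₂ a₃).E23 (S.incl v) = 0 := by
  have : (S.Wq h a₁ a₂ a₃).E23 ∘ₗ S.incl = 0 := S.v_ext fun i _ => by
    rw [LinearMap.comp_apply, incl_vvec, E23_0, LinearMap.zero_apply]
  exact LinearMap.congr_fun this v

end Signature

/-! ### Homomorphisms and invariant subspaces -/

section Homomorphisms

variable {V W : Type*} [AddCommGroup V] [Module ℂ V] [AddCommGroup W] [Module ℂ W]
  {ρ : Ops V} {σ : Ops W}

theorem Intertwines.invariant_map {f : V →ₗ[ℂ] W} (hf : Intertwines ρ σ f) {N : Submodule ℂ V}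
    (hN : ρ.Invariant N) : σ.Invariant (N.map f) := by
  constructor <;> rintro _ ⟨v, hv, rfl⟩ <;> rw [Submodule.mem_comap]
  · exact ⟨_, hN.E11 hv, hf.E11 v⟩
  · exact ⟨_, hN.E22 hv, hf.E22 v⟩
  · exact ⟨_, hN.E33 hv, hf.E33 v⟩
  · exact ⟨_, hN.E12 hv, hf.E12 v⟩
  · exact ⟨_, hN.E21 hv, hf.E21 v⟩
  · exact ⟨_, hN.E23 hv, hf.E23 v⟩
  · exact ⟨_, hN.E32 hv, hf.E32 v⟩

theorem Intertwines.invariant_comap {f : V →ₗ[ℂ] W} (hf : Intertwines ρ σ f)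
    {N : Submodule ℂ W} (hN : σ.Invariant N) : ρ.Invariant (N.comap f) := by
  constructor <;> intro v hv <;> simp only [Submodule.mem_comap] at hv ⊢
  · rw [hf.E11]; exact hN.E11 hv
  · rw [hf.E22]; exact hN.E22 hv
  · rw [hf.E33]; exact hN.E33 hv
  · rw [hf.E12]; exact hN.E12 hv
  · rw [hf.E21]; exact hN.E21 hv
  · rw [hf.E23]; exact hN.E23 hv
  · rw [hf.E32]; exact hN.E32 hv

theorem Intertwines.invariant_eqLocus {f g : V →ₗ[ℂ] W} (hf : Intertwines ρ σ f)
    (hg : Intertwines ρ σ g) : ρ.Invariant (LinearMap.eqLocus f g) := by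
  constructor <;> intro v hv <;> simp only [Submodule.mem_comap, LinearMap.mem_eqLocus] at hv ⊢
  · rw [hf.E11, hg.E11, hv]
  · rw [hf.E22, hg.E22, hv]
  · rw [hf.E33, hg.E33, hv]
  · rw [hf.E12, hg.E12, hv]
  · rw [hf.E21, hg.E21, hv]
  · rw [hf.E23, hg.E23, hv]
  · rw [hf.E32, hg.E32, hv]

theorem Ops.invariant_bot (ρ : Ops V) : ρ.Invariant ⊥ := by
  constructor <;> exact bot_le

theorem Ops.invariant_top (ρ : Ops V) : ρ.Invariant ⊤ := by
  constructor <;> exact fun _ _ => Submodule.mem_top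

end Homomorphisms

namespace Signature

variable (S : Signature) {h a₁ a₂ a₃ : ℂ}

/-- The graph of the extension is the subspace `Y` of `V × W^q` generated by the pairs `(f v, incl
v)`; a dimension count makes its projection to `W^q` bijective. -/
theorem exists_extension (hq : Generic h) (ha₁ : a₁ ≠ 0) (ha₂ : a₂ ≠ 0) (ha₃ : a₃ ≠ 0)
    {V : Type*} [AddCommGroup V] [Module ℂ V] [FiniteDimensional ℂ V] {ρ : Ops V}
    (hρ : ρ.IsRep h) {f : S.VSpace →ₗ[ℂ] V} (hf : EvenIntertwines (S.Vq h) ρ.toEvenOps f)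
    (hf0 : ∀ v, ρ.E23 (f v) = 0) :
    ∃ g : S.WSpace →ₗ[ℂ] V, Intertwines (S.Wq h a₁ a₂ a₃) ρ g ∧ g ∘ₗ S.incl = f := by
  set σ := S.Wq h a₁ a₂ a₃
  have hσ : σ.IsRep h := S.Wq_isRep hq ha₁ ha₂ ha₃
  have hj : EvenIntertwines (S.Vq h) σ.toEvenOps S.incl := S.incl_evenIntertwines
  set F := f.prod S.incl
  set X := LinearMap.range F
  have hX : Primitive (ρ.prod σ) X := by
    constructor <;> rintro _ ⟨v, rfl⟩
    · exact ⟨(S.Vq h).E11 v, Prod.ext (hf.E11 v) (hj.E11 v)⟩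
    · exact ⟨(S.Vq h).E22 v, Prod.ext (hf.E22 v) (hj.E22 v)⟩
    · exact ⟨(S.Vq h).E33 v, Prod.ext (hf.E33 v) (hj.E33 v)⟩
    · exact ⟨(S.Vq h).E12 v, Prod.ext (hf.E12 v) (hj.E12 v)⟩
    · exact ⟨(S.Vq h).E21 v, Prod.ext (hf.E21 v) (hj.E21 v)⟩
    · exact Prod.ext (hf0 v) (S.E23_incl v)
  set Y := generated h (ρ.prod σ) X
  have hY : (ρ.prod σ).Invariant Y := hX.invariant_generated hq (isRep_prod hρ hσ)
  set p : Y →ₗ[ℂ] S.WSpace := LinearMap.snd ℂ V S.WSpace ∘ₗ Y.subtype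
  have hXY : ∀ v, F v ∈ Y := fun v => mem_generated ⟨v, rfl⟩
  have hsurj : Function.Surjective p := by
    rw [← LinearMap.range_eq_top, LinearMap.range_comp, Submodule.range_subtype]
    refine S.eq_top_of_highest_mem hq ha₁ ha₂ ha₃ ((intertwines_snd ρ σ).invariant_map hY) ?_
    exact ⟨F (S.vvec 0), hXY _, S.incl_vvec 0⟩
  have hdim : Module.finrank ℂ Y = Module.finrank ℂ S.WSpace := by
    refine le_antisymm ?_ (LinearMap.finrank_le_finrank_of_surjective hsurj)
    have h1 : Module.finrank ℂ Y ≤ _ := finrank_generated_le X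
    have h2 : Module.finrank ℂ X ≤ _ := LinearMap.finrank_range_le F
    have h3 := S.card_label_ge
    rw [Module.finrank_fin_fun] at h2
    rw [Module.finrank_fintype_fun_eq_card]
    omega
  set e := LinearEquiv.ofBijective p
    ⟨(LinearMap.injective_iff_surjective_of_finrank_eq_finrank hdim).2 hsurj, hsurj⟩
  have he : ∀ y : Y, e y = (y : V × S.WSpace).2 := fun y => rfl
  have hg : ∀ y : V × S.WSpace, ∀ hy : y ∈ Y, e.symm y.2 = ⟨y, hy⟩ := fun y hy => by
    rw [LinearEquiv.symm_apply_eq, he]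
  refine ⟨LinearMap.fst ℂ V S.WSpace ∘ₗ Y.subtype ∘ₗ e.symm.toLinearMap, ?_, ?_⟩
  · have key : ∀ {A : Module.End ℂ V} {B : Module.End ℂ S.WSpace},
        (Y ≤ Y.comap (A.prodMap B)) → ∀ w, (e.symm (B w) : V × S.WSpace).1 =
          A (e.symm w : V × S.WSpace).1 := by
      intro A B hAB w
      obtain ⟨⟨y, hy⟩, rfl⟩ := e.surjective w
      rw [e.symm_apply_apply, he, show B y.2 = (A.prodMap B y).2 from rfl, hg _ (hAB hy)]
      rfl
    exact ⟨⟨key hY.E11, key hY.E22, key hY.E33, key hY.E12, key hY.E21⟩, key hY.E23, key hY.E32⟩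
  · refine LinearMap.ext fun v => ?_
    change (e.symm (F v).2 : V × S.WSpace).1 = f v
    rw [hg _ (hXY v)]
    rfl

theorem hom_ext (hq : Generic h) (ha₁ : a₁ ≠ 0) (ha₂ : a₂ ≠ 0) (ha₃ : a₃ ≠ 0)
    {V : Type*} [AddCommGroup V] [Module ℂ V] {ρ : Ops V} {f g : S.WSpace →ₗ[ℂ] V}
    (hf : Intertwines (S.Wq h a₁ a₂ a₃) ρ f) (hg : Intertwines (S.Wq h a₁ a₂ a₃) ρ g)
    (hfg : f ∘ₗ S.incl = g ∘ₗ S.incl) : f = g := by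
  refine LinearMap.eqLocus_eq_top.1
    (S.eq_top_of_highest_mem hq ha₁ ha₂ ha₃ (hf.invariant_eqLocus hg) ?_)
  rw [LinearMap.mem_eqLocus, ← incl_vvec]
  exact LinearMap.congr_fun hfg _

theorem isInduced (hq : Generic h) (ha₁ : a₁ ≠ 0) (ha₂ : a₂ ≠ 0) (ha₃ : a₃ ≠ 0) :
    IsInduced.{u} h (S.Vq h) (S.Wq h a₁ a₂ a₃) S.incl := by
  refine ⟨S.incl_evenIntertwines, S.E23_incl, fun V _ _ _ ρ hρ f hf hf0 => ?_⟩
  obtain ⟨g, hg, hgf⟩ := S.exists_extension hq ha₁ ha₂ ha₃ hρ hf hf0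
  exact ⟨g, ⟨hg, hgf⟩, fun g' hg' =>
    S.hom_ext hq ha₁ ha₂ ha₃ hg'.1 hg (hg'.2.trans hgf.symm)⟩

end Signature

/-! ### Maximal submodules of `W^q([m])` -/

theorem aeval_apply_of_diagonal {ι : Type*} {T : Module.End ℂ (ι → ℂ)} {d : ι → ℂ}
    (hT : ∀ w p, T w p = d p * w p) (P : Polynomial ℂ) (w : ι → ℂ) (p : ι) :
    Polynomial.aeval T P w p = P.eval (d p) * w p := by
  induction P using Polynomial.induction_on' with
  | add P Q hP hQ => simp [hP, hQ, add_mul]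
  | monomial n a =>
    have : (T ^ n) w p = d p ^ n * w p := by
      induction n with
      | zero => simp
      | succ n ih => rw [pow_succ', Module.End.mul_apply, hT, ih]; ring
    simp [Polynomial.aeval_monomial, this, mul_assoc]

theorem aeval_mem {V : Type*} [AddCommGroup V] [Module ℂ V] {T : Module.End ℂ V}
    {N : Submodule ℂ V} (hN : ∀ w ∈ N, T w ∈ N) (P : Polynomial ℂ) {w : V} (hw : w ∈ N) :
    Polynomial.aeval T P w ∈ N := by
  induction P using Polynomial.induction_on' with
  | add P Q hP hQ => simpa using N.add_mem hP hQ
  | monomial n a =>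
    have : (T ^ n) w ∈ N := by
      induction n with
      | zero => simpa
      | succ n ih => rw [pow_succ', Module.End.mul_apply]; exact hN _ ih
    simpa [Polynomial.aeval_monomial] using N.smul_mem a this

theorem component_mem {ι : Type*} [Fintype ι] {T : Module.End ℂ (ι → ℂ)} {d : ι → ℂ}
    (hT : ∀ w p, T w p = d p * w p) {N : Submodule ℂ (ι → ℂ)} (hN : ∀ w ∈ N, T w ∈ N) (c : ℂ)
    {w : ι → ℂ} (hw : w ∈ N) : (fun p => if d p = c then w p else 0) ∈ N := by
  classical
  -- The Lagrange polynomial equal to `1` at `c` and `0` at the other eigenvalues turns `T` into the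
  -- projection onto its `c`-eigenspace.
  have := aeval_mem hN
    (Lagrange.interpolate (Finset.univ.image d) id fun x => if x = c then 1 else 0) hw
  convert this using 1
  funext p
  rw [aeval_apply_of_diagonal hT]
  have := Lagrange.eval_interpolate_at_node (s := Finset.univ.image d) (v := id)
    (fun x => if x = c then (1 : ℂ) else 0) (Set.injOn_id _)
    (Finset.mem_image_of_mem d (Finset.mem_univ p))
  rw [id] at this
  rw [this]
  simp

namespace Signature

variable (S : Signature) {h a₁ a₂ a₃ : ℂ}

theorem E11_apply (w : S.WSpace) (p : Label S.n) :
    (S.Wq h a₁ a₂ a₃).E11 w p = S.m11 p.1.2 * w p := by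
  have : LinearMap.proj p ∘ₗ (S.Wq h a₁ a₂ a₃).E11 =
      S.m11 p.1.2 • (LinearMap.proj p : S.WSpace →ₗ[ℂ] ℂ) := S.w_ext fun k i => by
    simp only [LinearMap.comp_apply, E11_wvec, LinearMap.proj_apply, LinearMap.smul_apply,
      Pi.smul_apply, wvec, smul_eq_mul]
    split_ifs with hp
    · rw [hp.2]
    · rw [mul_zero, mul_zero]
  exact LinearMap.congr_fun this w

theorem E33_apply (w : S.WSpace) (p : Label S.n) :
    (S.Wq h a₁ a₂ a₃).E33 w p = S.m32 p.1.1 * w p := by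
  have : LinearMap.proj p ∘ₗ (S.Wq h a₁ a₂ a₃).E33 =
      S.m32 p.1.1 • (LinearMap.proj p : S.WSpace →ₗ[ℂ] ℂ) := S.w_ext fun k i => by
    simp only [LinearMap.comp_apply, E33_wvec, LinearMap.proj_apply, LinearMap.smul_apply,
      Pi.smul_apply, wvec, smul_eq_mul]
    split_ifs with hp
    · rw [hp.1]
    · rw [mul_zero, mul_zero]
  exact LinearMap.congr_fun this w

/-- The coefficient of `(m)_k`, `m₁₁ = m₁₃ - i`, in a vector of `W^q([m])`. -/
noncomputable def coeff (w : S.WSpace) (k : Fin 4) (i : ℕ) : ℂ :=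
  ∑ p : Label S.n, if p.1.1 = k ∧ (p.1.2 : ℕ) = i then w p else 0

theorem coeff_label (w : S.WSpace) (p : Label S.n) : S.coeff w p.1.1 p.1.2 = w p := by
  rw [coeff, Finset.sum_eq_single p]
  · simp
  · rintro b - hb
    rw [if_neg]
    rintro ⟨h1, h2⟩
    exact hb (Subtype.ext (Prod.ext h1 (Fin.ext h2)))
  · simp

theorem coeff_mul_wvec (w : S.WSpace) (k : Fin 4) (i : ℕ) (p : Label S.n) :
    S.coeff w k i * S.wvec k i p = if p.1.1 = k ∧ (p.1.2 : ℕ) = i then w p else 0 := by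
  rw [wvec]
  split_ifs with hp
  · rw [← hp.1, ← hp.2, coeff_label, mul_one]
  · rw [mul_zero]

/-- `E₁₁` detects `i` and `E₃₃` detects `top k + bot k`. Thus `k = 0` and `k = 3` are isolated,
whereas `(m)_1` and `(m)_2` share a weight and must be treated together. -/
theorem weight_component_mem {N : Submodule ℂ S.WSpace} (hN : (S.Wq h a₁ a₂ a₃).Invariant N)
    {w : S.WSpace} (hw : w ∈ N) (i t : ℕ) :
    (fun p : Label S.n => if (p.1.2 : ℕ) = i ∧ top p.1.1 + bot p.1.1 = t then w p else 0)
      ∈ N := by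
  have h1 := component_mem (N := N) (S.E11_apply (h := h) (a₁ := a₁) (a₂ := a₂) (a₃ := a₃))
    (fun w hw => hN.E11 hw) (S.m11 i) hw
  have h2 := component_mem (N := N) (S.E33_apply (h := h) (a₁ := a₁) (a₂ := a₂) (a₃ := a₃))
    (fun w hw => hN.E33 hw) (S.m33 + t) h1
  convert h2 using 1
  funext p
  have e1 : S.m11 p.1.2 = S.m11 i ↔ (p.1.2 : ℕ) = i := by
    rw [m11, m11, sub_right_inj, Nat.cast_inj]
  have e2 : S.m32 p.1.1 = S.m33 + t ↔ top p.1.1 + bot p.1.1 = t := by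
    rw [m32, add_assoc, add_right_inj]
    exact_mod_cast Iff.rfl
  simp only [e1, e2]
  split_ifs <;> tauto

theorem coeff_zero_smul_mem {N : Submodule ℂ S.WSpace} (hN : (S.Wq h a₁ a₂ a₃).Invariant N)
    {w : S.WSpace} (hw : w ∈ N) (i : ℕ) : S.coeff w 0 i • S.wvec 0 i ∈ N := by
  convert S.weight_component_mem hN hw i 0 using 1
  funext ⟨⟨k, j⟩, hp⟩
  rw [Pi.smul_apply, smul_eq_mul, coeff_mul_wvec]
  fin_cases k <;> simp [top, bot]

theorem coeff_three_smul_mem {N : Submodule ℂ S.WSpace} (hN : (S.Wq h a₁ a₂ a₃).Invariant N)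
    {w : S.WSpace} (hw : w ∈ N) (i : ℕ) : S.coeff w 3 i • S.wvec 3 i ∈ N := by
  convert S.weight_component_mem hN hw i 2 using 1
  funext ⟨⟨k, j⟩, hp⟩
  rw [Pi.smul_apply, smul_eq_mul, coeff_mul_wvec]
  fin_cases k <;> simp [top, bot]

theorem coeff_one_two_smul_mem {N : Submodule ℂ S.WSpace} (hN : (S.Wq h a₁ a₂ a₃).Invariant N)
    {w : S.WSpace} (hw : w ∈ N) (i : ℕ) :
    S.coeff w 1 i • S.wvec 1 i + S.coeff w 2 i • S.wvec 2 i ∈ N := by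
  convert S.weight_component_mem hN hw i 1 using 1
  funext ⟨⟨k, j⟩, hp⟩
  rw [Pi.add_apply, Pi.smul_apply, Pi.smul_apply, smul_eq_mul, smul_eq_mul, coeff_mul_wvec,
    coeff_mul_wvec]
  fin_cases k <;> simp [top, bot]

theorem eq_top_of_level_zero (hq : Generic h) (ha₁ : a₁ ≠ 0) (ha₂ : a₂ ≠ 0) (ha₃ : a₃ ≠ 0)
    {N : Submodule ℂ S.WSpace} (hN : (S.Wq h a₁ a₂ a₃).Invariant N)
    {i : ℕ} (hi : i ≤ S.n) (hv : S.wvec 0 i ∈ N) : N = ⊤ := by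
  induction i with
  | zero => exact S.eq_top_of_highest_mem hq ha₁ ha₂ ha₃ hN hv
  | succ i ih =>
    refine ih (by omega) ?_
    have := hN.E12 hv
    rw [Submodule.mem_comap, E12_0] at this
    exact (N.smul_mem_iff (mul_ne_zero (rr_ne h hq (by omega)) (S.ss_ne h hq hi))).1 this

/-- `E₁₂` brings `i` down to `0` and keeps the `(m)_1` coefficient nonzero. At `i = 0` the `(m)_2`
part disappears, and `E₂₃` gives a nonzero multiple, containing `ξ`, of the highest vector. -/
theorem eq_top_of_level_one (hq : Generic h) (ha₁ : a₁ ≠ 0) (ha₂ : a₂ ≠ 0) (ha₃ : a₃ ≠ 0)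
    {N : Submodule ℂ S.WSpace} (hN : (S.Wq h a₁ a₂ a₃).Invariant N)
    (hxi : S.xi h ≠ 0) {i : ℕ} (hi : i ≤ S.n + 1) {α β : ℂ} (hα : α ≠ 0)
    (hv : α • S.wvec 1 i + β • S.wvec 2 i ∈ N) : N = ⊤ := by
  induction i generalizing α β with
  | zero =>
    refine S.eq_top_of_highest_mem hq ha₁ ha₂ ha₃ hN ?_
    have := hN.E23 hv
    rw [Submodule.mem_comap, map_add, map_smul, map_smul, E23_1, E23_2, rr_zero, mul_zero,
      zero_smul, smul_zero, add_zero, smul_smul] at this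
    exact (N.smul_mem_iff (mul_ne_zero hα (mul_ne_zero (mul_ne_zero
      (div_ne_zero ha₁ (S.rt_succ_ne h hq)) hxi) (S.ss_ne h hq (Nat.zero_le _))))).1 this
  | succ i ih =>
    have := hN.E12 hv
    rw [Submodule.mem_comap, map_add, map_smul, map_smul, E12_1, E12_2, smul_smul,
      smul_smul] at this
    exact ih (by omega) (mul_ne_zero hα (mul_ne_zero (rr_ne h hq (by omega))
      (S.ss_ne h hq (by omega)))) this

theorem eq_top_of_level_two (hq : Generic h) (ha₁ : a₁ ≠ 0) (ha₂ : a₂ ≠ 0) (ha₃ : a₃ ≠ 0)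
    {N : Submodule ℂ S.WSpace} (hN : (S.Wq h a₁ a₂ a₃).Invariant N)
    (heta : S.eta h ≠ 0) {i : ℕ} (hi : 1 ≤ i) (hi' : i ≤ S.n) {α β : ℂ}
    (hβ : β ≠ 0) (hv : α • S.wvec 1 i + β • S.wvec 2 i ∈ N) : N = ⊤ := by
  -- In `E₂₃` of the vector, the two contributions to `(m)_0` could cancel. If `α ξ = 0` only the
  -- one with `η` is present; otherwise the previous case applies.
  by_cases hαξ : α * S.xi h = 0
  · refine S.eq_top_of_level_zero hq ha₁ ha₂ ha₃ hN hi' ?_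
    have := hN.E23 hv
    rw [Submodule.mem_comap, map_add, map_smul, map_smul, E23_1, E23_2, smul_smul, smul_smul,
      show α * (a₁ / rt h (S.n + 1) * S.xi h * S.ss h i) =
        (α * S.xi h) * (a₁ / rt h (S.n + 1) * S.ss h i) by ring, hαξ, zero_mul, zero_smul,
      zero_add] at this
    exact (N.smul_mem_iff (mul_ne_zero hβ (mul_ne_zero (mul_ne_zero
      (div_ne_zero ha₂ (S.nu_ne h hq)) heta) (rr_ne h hq (by omega))))).1 this
  · exact S.eq_top_of_level_one hq ha₁ ha₂ ha₃ hN (right_ne_zero_of_mul hαξ) (by omega)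
      (left_ne_zero_of_mul hαξ) hv

theorem eq_top_of_level_three (hq : Generic h) (ha₁ : a₁ ≠ 0) (ha₂ : a₂ ≠ 0) (ha₃ : a₃ ≠ 0)
    {N : Submodule ℂ S.WSpace} (hN : (S.Wq h a₁ a₂ a₃).Invariant N)
    (hxi : S.xi h ≠ 0) (heta : S.eta h ≠ 0) {i : ℕ} (hi : 1 ≤ i)
    (hi' : i ≤ S.n + 1) (hv : S.wvec 3 i ∈ N) : N = ⊤ := by
  have := hN.E23 hv
  rw [Submodule.mem_comap, E23_3, sub_eq_add_neg, ← neg_smul] at this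
  exact S.eq_top_of_level_one hq ha₁ ha₂ ha₃ hN hxi hi' (mul_ne_zero (mul_ne_zero
    (div_ne_zero ha₃ (mul_ne_zero (mul_ne_zero ha₁ (Complex.exp_ne_zero h))
      (S.rt_succ_ne h hq))) heta) (rr_ne h hq (by omega))) this

/-- An invariant subspace is everything if it contains a vector with a suitable coordinate. -/
theorem eq_top_of_apply_ne (hq : Generic h) (ha₁ : a₁ ≠ 0) (ha₂ : a₂ ≠ 0) (ha₃ : a₃ ≠ 0)
    {N : Submodule ℂ S.WSpace} (hN : (S.Wq h a₁ a₂ a₃).Invariant N)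
    {w : S.WSpace} (hw : w ∈ N) {p : Label S.n} (hp : w p ≠ 0)
    (h1 : p.1.1 = 1 → S.xi h ≠ 0) (h2 : p.1.1 = 2 → S.eta h ≠ 0)
    (h3 : p.1.1 = 3 → S.xi h ≠ 0 ∧ S.eta h ≠ 0) : N = ⊤ := by
  rw [← S.coeff_label w p] at hp
  obtain ⟨⟨k, i⟩, hki⟩ := p
  fin_cases k <;> simp only [top, bot] at hki <;> simp at hki h1 h2 h3 hp
  · exact S.eq_top_of_level_zero hq ha₁ ha₂ ha₃ hN (by omega)
      ((N.smul_mem_iff hp).1 (S.coeff_zero_smul_mem hN hw i))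
  · exact S.eq_top_of_level_one hq ha₁ ha₂ ha₃ hN h1 (by omega) hp
      (S.coeff_one_two_smul_mem hN hw i)
  · exact S.eq_top_of_level_two hq ha₁ ha₂ ha₃ hN h2 (by omega) (by omega) hp
      (S.coeff_one_two_smul_mem hN hw i)
  · exact S.eq_top_of_level_three hq ha₁ ha₂ ha₃ hN h3.1 h3.2 (by omega) (by omega)
      ((N.smul_mem_iff hp).1 (S.coeff_three_smul_mem hN hw i))

end Signature

/-- `I` is the largest proper invariant subspace. -/
structure IsLargest {W : Type*} [AddCommGroup W] [Module ℂ W] (σ : Ops W) (I : Submodule ℂ W) :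
    Prop where
  invariant : σ.Invariant I
  ne_top : I ≠ ⊤
  eq_top : ∀ N, σ.Invariant N → ¬N ≤ I → N = ⊤

namespace Signature

variable (S : Signature) {h a₁ a₂ a₃ : ℂ}

theorem mem_of_apply_ne {N : Submodule ℂ S.WSpace} {w : S.WSpace}
    (hw : ∀ p, w p ≠ 0 → S.wvec p.1.1 p.1.2 ∈ N) : w ∈ N := by
  rw [pi_eq_sum_univ' w]
  refine N.sum_mem fun p _ => ?_
  by_cases hp : w p = 0
  · rw [hp, zero_smul]
    exact N.zero_mem
  · have := hw p hp
    rw [wvec_label] at this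
    convert N.smul_mem (w p) this using 2

theorem wvec_mem_Vk (k : Fin 4) (i : ℕ) : S.wvec k i ∈ S.Vk k :=
  Submodule.subset_span ⟨i, rfl⟩

theorem Vk_le_iff {k : Fin 4} {N : Submodule ℂ S.WSpace} :
    S.Vk k ≤ N ↔ ∀ i, S.wvec k i ∈ N := by
  rw [Vk, Submodule.span_le, Set.range_subset_iff]
  rfl

theorem highest_notMem_of_Vk {j k : Fin 4} (hj : j ≠ 0) (hk : k ≠ 0) :
    S.Vk j ⊔ S.Vk k ≠ ⊤ := by
  intro htop
  let p : Label S.n := ⟨(0, 0), by simp [top, bot]⟩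
  have hle : S.Vk j ⊔ S.Vk k ≤ LinearMap.ker (LinearMap.proj p : S.WSpace →ₗ[ℂ] ℂ) :=
    sup_le (S.Vk_le_iff.2 fun i => by simp [wvec, p, hj.symm])
      (S.Vk_le_iff.2 fun i => by simp [wvec, p, hk.symm])
  have : S.wvec 0 0 ∈ S.Vk j ⊔ S.Vk k := by rw [htop]; exact Submodule.mem_top
  have := hle this
  simp [wvec, p] at this

theorem invariant_Vk_sup {j k : Fin 4}
    (h23 : ∀ i, (S.Wq h a₁ a₂ a₃).E23 (S.wvec j i) ∈ S.Vk j ⊔ S.Vk k ∧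
      (S.Wq h a₁ a₂ a₃).E23 (S.wvec k i) ∈ S.Vk j ⊔ S.Vk k)
    (h32 : ∀ i, (S.Wq h a₁ a₂ a₃).E32 (S.wvec j i) ∈ S.Vk j ⊔ S.Vk k ∧
      (S.Wq h a₁ a₂ a₃).E32 (S.wvec k i) ∈ S.Vk j ⊔ S.Vk k) :
    (S.Wq h a₁ a₂ a₃).Invariant (S.Vk j ⊔ S.Vk k) := by
  have mj : ∀ i, S.wvec j i ∈ S.Vk j ⊔ S.Vk k :=
    fun i => Submodule.mem_sup_left (S.wvec_mem_Vk j i)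
  have mk : ∀ i, S.wvec k i ∈ S.Vk j ⊔ S.Vk k :=
    fun i => Submodule.mem_sup_right (S.wvec_mem_Vk k i)
  constructor <;> refine sup_le (S.Vk_le_iff.2 fun i => ?_) (S.Vk_le_iff.2 fun i => ?_) <;>
    rw [Submodule.mem_comap]
  · rw [E11_wvec]; exact Submodule.smul_mem _ _ (mj _)
  · rw [E11_wvec]; exact Submodule.smul_mem _ _ (mk _)
  · rw [E22_wvec]; exact Submodule.smul_mem _ _ (mj _)
  · rw [E22_wvec]; exact Submodule.smul_mem _ _ (mk _)
  · rw [E33_wvec]; exact Submodule.smul_mem _ _ (mj _)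
  · rw [E33_wvec]; exact Submodule.smul_mem _ _ (mk _)
  · rw [E12_wvec]; exact Submodule.smul_mem _ _ (mj _)
  · rw [E12_wvec]; exact Submodule.smul_mem _ _ (mk _)
  · rw [E21_wvec]; exact Submodule.smul_mem _ _ (mj _)
  · rw [E21_wvec]; exact Submodule.smul_mem _ _ (mk _)
  · exact (h23 i).1
  · exact (h23 i).2
  · exact (h32 i).1
  · exact (h32 i).2

theorem isLargest_bot (hq : Generic h) (ha₁ : a₁ ≠ 0) (ha₂ : a₂ ≠ 0) (ha₃ : a₃ ≠ 0)
    (hS : S.Typical h) : IsLargest (S.Wq h a₁ a₂ a₃) ⊥ where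
  invariant := Ops.invariant_bot _
  ne_top e := by
    have : S.wvec 0 0 ∈ (⊥ : Submodule ℂ S.WSpace) := by rw [e]; exact Submodule.mem_top
    have := congrFun ((Submodule.mem_bot ℂ).1 this) ⟨(0, 0), by simp [top, bot]⟩
    simp [wvec] at this
  eq_top N hN hle := by
    obtain ⟨w, hw, hw0⟩ := SetLike.not_le_iff_exists.1 hle
    obtain ⟨p, hp⟩ := Function.ne_iff.1 hw0
    have hxi : S.xi h ≠ 0 := right_ne_zero_of_mul hS
    have heta : S.eta h ≠ 0 := left_ne_zero_of_mul hS
    exact S.eq_top_of_apply_ne hq ha₁ ha₂ ha₃ hN hw hp (fun _ => hxi) (fun _ => heta)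
      fun _ => ⟨hxi, heta⟩

/-- The arrows `(m)_3 → (m)_1` and `(m)_2 → (m)_0` of `E₂₃` carry the factor `η` and disappear. As
`ξ ≠ 0`, any vector with a nonzero `(m)_0` or `(m)_1` coordinate still generates everything. -/
theorem isLargest_I1 (hq : Generic h) (ha₁ : a₁ ≠ 0) (ha₂ : a₂ ≠ 0) (ha₃ : a₃ ≠ 0)
    (hS : S.Class1 h) : IsLargest (S.Wq h a₁ a₂ a₃) S.I1 where
  invariant := by
    have heta : S.eta h = 0 := hS.1
    refine S.invariant_Vk_sup (fun i => ⟨?_, ?_⟩) fun i => ⟨?_, ?_⟩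
    · rw [E23_3, heta, mul_zero, zero_mul, zero_smul, zero_sub]
      exact Submodule.neg_mem _ (Submodule.smul_mem _ _
        (Submodule.mem_sup_right (S.wvec_mem_Vk 2 i)))
    · rw [E23_2, heta, mul_zero, zero_mul, zero_smul]
      exact Submodule.zero_mem _
    · rw [E32_3]
      exact Submodule.zero_mem _
    · rw [E32_2]
      exact Submodule.smul_mem _ _ (Submodule.mem_sup_left (S.wvec_mem_Vk 3 i))
  ne_top := S.highest_notMem_of_Vk (by decide) (by decide)
  eq_top N hN hle := by
    obtain ⟨w, hw, hwI⟩ := SetLike.not_le_iff_exists.1 hle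
    by_contra hne
    refine hwI (S.mem_of_apply_ne fun p hp => ?_)
    obtain ⟨⟨k, i⟩, hki⟩ := p
    fin_cases k
    · exact absurd (S.eq_top_of_apply_ne hq ha₁ ha₂ ha₃ hN hw hp (by simp) (by simp) (by simp)) hne
    · exact absurd (S.eq_top_of_apply_ne hq ha₁ ha₂ ha₃ hN hw hp (fun _ => hS.2) (by simp)
        (by simp)) hne
    · exact Submodule.mem_sup_right (S.wvec_mem_Vk 2 i)
    · exact Submodule.mem_sup_left (S.wvec_mem_Vk 3 i)

/-- Now the arrows `(m)_3 → (m)_2` and `(m)_1 → (m)_0`, with factor `ξ`, disappear, while `η ≠ 0`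
takes care of the `(m)_2` coordinates. -/
theorem isLargest_I2 (hq : Generic h) (ha₁ : a₁ ≠ 0) (ha₂ : a₂ ≠ 0) (ha₃ : a₃ ≠ 0)
    (hS : S.Class2 h) : IsLargest (S.Wq h a₁ a₂ a₃) S.I2 where
  invariant := by
    have hxi : S.xi h = 0 := hS.2
    refine S.invariant_Vk_sup (fun i => ⟨?_, ?_⟩) fun i => ⟨?_, ?_⟩
    · rw [E23_3, hxi, mul_zero, zero_mul, zero_smul, sub_zero]
      exact Submodule.smul_mem _ _ (Submodule.mem_sup_right (S.wvec_mem_Vk 1 i))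
    · rw [E23_1, hxi, mul_zero, zero_mul, zero_smul]
      exact Submodule.zero_mem _
    · rw [E32_3]
      exact Submodule.zero_mem _
    · rw [E32_1]
      exact Submodule.smul_mem _ _ (Submodule.mem_sup_left (S.wvec_mem_Vk 3 i))
  ne_top := S.highest_notMem_of_Vk (by decide) (by decide)
  eq_top N hN hle := by
    obtain ⟨w, hw, hwI⟩ := SetLike.not_le_iff_exists.1 hle
    by_contra hne
    refine hwI (S.mem_of_apply_ne fun p hp => ?_)
    obtain ⟨⟨k, i⟩, hki⟩ := p
    fin_cases k
    · exact absurd (S.eq_top_of_apply_ne hq ha₁ ha₂ ha₃ hN hw hp (by simp) (by simp) (by simp)) hne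
    · exact Submodule.mem_sup_right (S.wvec_mem_Vk 1 i)
    · exact absurd (S.eq_top_of_apply_ne hq ha₁ ha₂ ha₃ hN hw hp (by simp) (fun _ => hS.1)
        (by simp)) hne
    · exact Submodule.mem_sup_left (S.wvec_mem_Vk 3 i)

end Signature

/-! ### Irreducible quotients -/

section Quotients

variable {V W : Type*} [AddCommGroup V] [Module ℂ V] [AddCommGroup W] [Module ℂ W]
  {ρ : Ops V} {σ : Ops W}

theorem Intertwines.symm {e : V ≃ₗ[ℂ] W} (he : Intertwines ρ σ e.toLinearMap) :
    Intertwines σ ρ e.symm.toLinearMap := by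
  refine ⟨⟨?_, ?_, ?_, ?_, ?_⟩, ?_, ?_⟩ <;> intro w <;> obtain ⟨v, rfl⟩ := e.surjective w <;>
    apply e.injective <;> simp only [LinearEquiv.coe_coe, e.apply_symm_apply, e.symm_apply_apply]
  · exact (he.E11 v).symm
  · exact (he.E22 v).symm
  · exact (he.E33 v).symm
  · exact (he.E12 v).symm
  · exact (he.E21 v).symm
  · exact (he.E23 v).symm
  · exact (he.E32 v).symm

theorem Intertwines.comp {X : Type*} [AddCommGroup X] [Module ℂ X] {τ : Ops X}
    {g : W →ₗ[ℂ] X} {f : V →ₗ[ℂ] W} (hg : Intertwines σ τ g) (hf : Intertwines ρ σ f) :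
    Intertwines ρ τ (g ∘ₗ f) := by
  refine ⟨⟨?_, ?_, ?_, ?_, ?_⟩, ?_, ?_⟩ <;> intro v <;>
    simp only [LinearMap.comp_apply]
  · rw [hf.E11, hg.E11]
  · rw [hf.E22, hg.E22]
  · rw [hf.E33, hg.E33]
  · rw [hf.E12, hg.E12]
  · rw [hf.E21, hg.E21]
  · rw [hf.E23, hg.E23]
  · rw [hf.E32, hg.E32]

theorem intertwines_mkQ (ρ : Ops V) {N : Submodule ℂ V} (hN : ρ.Invariant N) :
    Intertwines ρ (ρ.quot N hN) N.mkQ :=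
  ⟨⟨fun _ => rfl, fun _ => rfl, fun _ => rfl, fun _ => rfl, fun _ => rfl⟩, fun _ => rfl,
    fun _ => rfl⟩

theorem Intertwines.liftQ {f : V →ₗ[ℂ] W} (hf : Intertwines ρ σ f) {N : Submodule ℂ V}
    (hN : ρ.Invariant N) (hle : N ≤ LinearMap.ker f) :
    Intertwines (ρ.quot N hN) σ (N.liftQ f hle) := by
  refine ⟨⟨?_, ?_, ?_, ?_, ?_⟩, ?_, ?_⟩ <;> intro v <;> obtain ⟨v, rfl⟩ := N.mkQ_surjective v
  · exact hf.E11 v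
  · exact hf.E22 v
  · exact hf.E33 v
  · exact hf.E12 v
  · exact hf.E21 v
  · exact hf.E23 v
  · exact hf.E32 v

theorem Iso.exists_surjective_of_quot {N : Submodule ℂ W} {hN : σ.Invariant N}
    (hi : Iso ρ (σ.quot N hN)) :
    ∃ g : W →ₗ[ℂ] V, Intertwines σ ρ g ∧ Function.Surjective g ∧ LinearMap.ker g = N := by
  obtain ⟨e, he⟩ := hi
  refine ⟨e.symm.toLinearMap ∘ₗ N.mkQ, he.symm.comp (intertwines_mkQ σ hN),
    e.symm.surjective.comp N.mkQ_surjective, ?_⟩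
  rw [LinearEquiv.ker_comp, Submodule.ker_mkQ]

theorem Iso.exists_surjective (hi : Iso ρ σ) :
    ∃ g : W →ₗ[ℂ] V, Intertwines σ ρ g ∧ Function.Surjective g ∧ LinearMap.ker g = ⊥ := by
  obtain ⟨e, he⟩ := hi
  exact ⟨e.symm.toLinearMap, he.symm, e.symm.surjective, e.symm.ker⟩

theorem iso_quot_of_surjective {g : W →ₗ[ℂ] V} (hg : Intertwines σ ρ g)
    (hs : Function.Surjective g) {N : Submodule ℂ W} (hN : σ.Invariant N)
    (hk : LinearMap.ker g = N) : Iso ρ (σ.quot N hN) := by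
  have hb : Function.Bijective (N.liftQ g hk.ge) :=
    ⟨LinearMap.ker_eq_bot.1 (Submodule.ker_liftQ_eq_bot _ _ _ hk.le), fun v => by
      obtain ⟨w, rfl⟩ := hs v
      exact ⟨N.mkQ w, rfl⟩⟩
  have he : Intertwines (σ.quot N hN) ρ (LinearEquiv.ofBijective _ hb).toLinearMap :=
    hg.liftQ hN hk.ge
  exact ⟨_, he.symm⟩

theorem iso_of_surjective {g : W →ₗ[ℂ] V} (hg : Intertwines σ ρ g)
    (hs : Function.Surjective g) (hk : LinearMap.ker g = ⊥) : Iso ρ σ := by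
  have he : Intertwines σ ρ
      (LinearEquiv.ofBijective g ⟨LinearMap.ker_eq_bot.1 hk, hs⟩).toLinearMap := hg
  exact ⟨_, he.symm⟩

theorem IsLargest.irreducible {I : Submodule ℂ W} (hI : IsLargest σ I) {g : W →ₗ[ℂ] V}
    (hg : Intertwines σ ρ g) (hs : Function.Surjective g) (hk : LinearMap.ker g = I) :
    ρ.Irreducible := by
  constructor
  · by_contra hV
    rw [not_nontrivial_iff_subsingleton] at hV
    refine hI.ne_top (hk ▸ LinearMap.ker_eq_top.2 (LinearMap.ext fun w => Subsingleton.elim _ _))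
  · intro N hN
    by_cases hle : N.comap g ≤ I
    · left
      rw [eq_bot_iff]
      intro v hv
      obtain ⟨w, rfl⟩ := hs v
      have : w ∈ LinearMap.ker g := hk ▸ hle hv
      exact this
    · right
      have := hI.eq_top _ (hg.invariant_comap hN) hle
      rw [eq_top_iff]
      intro v _
      obtain ⟨w, rfl⟩ := hs v
      have hw : w ∈ N.comap g := by rw [this]; exact Submodule.mem_top
      exact hw

theorem Ops.Irreducible.surjective (hρ : ρ.Irreducible) {g : W →ₗ[ℂ] V}
    (hg : Intertwines σ ρ g) (h0 : g ≠ 0) : Function.Surjective g := by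
  rw [← LinearMap.range_eq_top, ← Submodule.map_top]
  refine (hρ.2 _ (hg.invariant_map σ.invariant_top)).resolve_left fun e => h0 ?_
  rwa [Submodule.map_top, LinearMap.range_eq_bot] at e

/-- The kernel is proper, hence inside `I`. The image of `I` is zero or everything; in the latter
case `I + ker g = W`, which contradicts `ker g ≤ I ≠ ⊤`. -/
theorem IsLargest.ker_eq {I : Submodule ℂ W} (hI : IsLargest σ I) (hρ : ρ.Irreducible)
    {g : W →ₗ[ℂ] V} (hg : Intertwines σ ρ g) (h0 : g ≠ 0) : LinearMap.ker g = I := by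
  have hle : LinearMap.ker g ≤ I := by
    by_contra hle
    exact h0 (LinearMap.ker_eq_top.1 (hI.eq_top _ (hg.invariant_comap ρ.invariant_bot) hle))
  refine le_antisymm hle ?_
  rcases hρ.2 _ (hg.invariant_map hI.invariant) with e | e
  · exact LinearMap.le_ker_iff_map.2 e
  · refine absurd ?_ hI.ne_top
    rw [eq_top_iff]
    intro w _
    have : g w ∈ I.map g := by rw [e]; exact Submodule.mem_top
    obtain ⟨w', hw', hww⟩ := this
    have : w - w' ∈ I := hle (by rw [LinearMap.mem_ker, map_sub, hww, sub_self])
    simpa using I.add_mem this hw'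

end Quotients

theorem Signature.regularWeights (S : Signature) {h a₁ a₂ a₃ : ℂ} (hq : Generic h) {V : Type*}
    [AddCommGroup V] [Module ℂ V] [FiniteDimensional ℂ V] {ρ : Ops V} {g : S.WSpace →ₗ[ℂ] V}
    (hg : Intertwines (S.Wq h a₁ a₂ a₃) ρ g) (hs : Function.Surjective g) :
    ρ.RegularWeights h := by
  set σ := S.Wq h a₁ a₂ a₃ with hσ
  intro c hc k hck
  have hint : ∃ z : ℤ, c = z := by
    by_contra hz
    push Not at hz
    -- `H₁` is diagonal on `W^q` with integer eigenvalues. For other `c`, `H₁ - c` is onto `W^q`,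
    -- hence onto `V`, hence injective there by finite dimension.
    have htop : LinearMap.range (σ.H1 - c • 1) = ⊤ := by
      refine S.eq_top_of_wvec_mem fun k i => ?_
      have hd : (S.n : ℂ) + top k + bot k - 2 * i - c ≠ 0 := by
        intro e
        refine hz (S.n + top k + bot k - 2 * i) ?_
        push_cast
        exact (sub_eq_zero.1 e).symm
      refine ⟨((S.n : ℂ) + top k + bot k - 2 * i - c)⁻¹ • S.wvec k i, ?_⟩
      rw [map_smul, LinearMap.sub_apply, hσ, H1_wvec, LinearMap.smul_apply, Module.End.one_apply,
        ← sub_smul, smul_smul, inv_mul_cancel₀ hd, one_smul]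
    have hH : Sem g σ.H1 ρ.H1 := Sem.sub hg.E11 hg.E22
    have hsurj : Function.Surjective (ρ.H1 - c • 1 : Module.End ℂ V) := by
      intro v
      obtain ⟨w, rfl⟩ := hs v
      obtain ⟨w', rfl⟩ := LinearMap.range_eq_top.1 htop w
      refine ⟨g w', ?_⟩
      simp [hH w']
    obtain ⟨v, hv, hv0⟩ := hc.exists_hasEigenvector
    have hinj := LinearMap.injective_iff_surjective.2 hsurj
    refine hv0 (hinj ?_)
    rw [Module.End.mem_eigenspace_iff] at hv
    simp [hv]
  obtain ⟨z, rfl⟩ := hint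
  by_contra hne
  refine qn_int_ne hq (k := z - k) ?_ ?_
  · intro e
    apply hne
    exact_mod_cast e
  · exact_mod_cast hck

/-! ### Highest weight vectors -/

section HighestWeight

variable {V : Type*} [AddCommGroup V] [Module ℂ V]

/-- A common eigenvector of the Cartan generators. -/
structure IsWeightVector (ρ : Ops V) (c₁ c₂ c₃ : ℂ) (v : V) : Prop where
  ne_zero : v ≠ 0
  E11 : ρ.E11 v = c₁ • v
  E22 : ρ.E22 v = c₂ • v
  E33 : ρ.E33 v = c₃ • v

variable [FiniteDimensional ℂ V] {h : ℂ} {ρ : Ops V}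

theorem exists_eigenvector_mem {N : Submodule ℂ V} (hN0 : N ≠ ⊥) {A : Module.End ℂ V}
    (hN : ∀ v ∈ N, A v ∈ N) : ∃ c : ℂ, ∃ v ∈ N, v ≠ 0 ∧ A v = c • v := by
  have := Submodule.nontrivial_iff_ne_bot.2 hN0
  obtain ⟨c, hc⟩ := Module.End.exists_eigenvalue (A.restrict hN)
  obtain ⟨v, hv, hv0⟩ := hc.exists_hasEigenvector
  rw [Module.End.mem_eigenspace_iff] at hv
  exact ⟨c, v, v.2, fun e => hv0 (Subtype.ext e), congrArg Subtype.val hv⟩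

theorem Ops.IsRep.exists_isWeightVector [Nontrivial V] (hρ : ρ.IsRep h) :
    ∃ c₁ c₂ c₃ v, IsWeightVector ρ c₁ c₂ c₃ v := by
  have h12 := brk_eq_iff.1 hρ.cartan12
  have h13 := brk_eq_iff.1 hρ.cartan13
  have h23 := brk_eq_iff.1 hρ.cartan23
  simp only [LinearMap.zero_apply, zero_add, one_smul] at h12 h13 h23
  obtain ⟨c₁, v₁, -, hv₁, e₁⟩ := exists_eigenvector_mem (N := ⊤) (A := ρ.E11) top_ne_bot
    fun _ _ => Submodule.mem_top
  let N₁ := LinearMap.ker (ρ.E11 - c₁ • 1 : Module.End ℂ V)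
  have m₁ : ∀ v, v ∈ N₁ ↔ ρ.E11 v = c₁ • v := fun v => by
    simp [N₁, LinearMap.mem_ker, sub_eq_zero]
  obtain ⟨c₂, v₂, hv₂', hv₂, e₂⟩ := exists_eigenvector_mem (N := N₁) (A := ρ.E22)
    ((Submodule.ne_bot_iff _).2 ⟨v₁, (m₁ v₁).2 e₁, hv₁⟩) fun v hv => by
      rw [m₁] at hv ⊢
      rw [h12, hv, map_smul]
  let N₂ := LinearMap.ker (ρ.E22 - c₂ • 1 : Module.End ℂ V)
  have m₂ : ∀ v, v ∈ N₂ ↔ ρ.E22 v = c₂ • v := fun v => by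
    simp [N₂, LinearMap.mem_ker, sub_eq_zero]
  obtain ⟨c₃, v₃, hv₃', hv₃, e₃⟩ := exists_eigenvector_mem (N := N₁ ⊓ N₂) (A := ρ.E33)
    ((Submodule.ne_bot_iff _).2 ⟨v₂, ⟨hv₂', (m₂ v₂).2 e₂⟩, hv₂⟩) fun v hv => by
      have h1 := (m₁ v).1 hv.1
      have h2 := (m₂ v).1 hv.2
      refine ⟨(m₁ _).2 ?_, (m₂ _).2 ?_⟩
      · rw [h13, h1, map_smul]
      · rw [h23, h2, map_smul]
  exact ⟨c₁, c₂, c₃, v₃, hv₃, (m₁ _).1 hv₃'.1, (m₂ _).1 hv₃'.2, e₃⟩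

/-- Both `E₁₂` and `E₂₃` raise `2 c₁ + c₂` by `1`, so a weight vector for which its real part is
maximal is killed by both. -/
theorem Ops.IsRep.exists_highest_weight [Nontrivial V] (hρ : ρ.IsRep h) :
    ∃ c₁ c₂ c₃ v, IsWeightVector ρ c₁ c₂ c₃ v ∧ ρ.E12 v = 0 ∧ ρ.E23 v = 0 := by
  set T : Set ℂ := {c | ∃ c₁ c₂ c₃ v, IsWeightVector ρ c₁ c₂ c₃ v ∧ c = 2 * c₁ + c₂}
  have hfin : T.Finite := by
    refine (Module.End.finite_hasEigenvalue ((2 : ℂ) • ρ.E11 + ρ.E22)).subset ?_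
    rintro _ ⟨c₁, c₂, c₃, v, hv, rfl⟩
    refine Module.End.hasEigenvalue_of_hasEigenvector (x := v)
      ⟨Module.End.mem_eigenspace_iff.2 ?_, hv.ne_zero⟩
    rw [LinearMap.add_apply, LinearMap.smul_apply, hv.E11, hv.E22, add_smul, smul_smul]
  have hne : T.Nonempty := by
    obtain ⟨c₁, c₂, c₃, v, hv⟩ := hρ.exists_isWeightVector
    exact ⟨_, c₁, c₂, c₃, v, hv, rfl⟩
  obtain ⟨_, ⟨c₁, c₂, c₃, v, hv, rfl⟩, hmax⟩ := Set.exists_max_image T Complex.re hfin hne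
  refine ⟨c₁, c₂, c₃, v, hv, ?_, ?_⟩
  · by_contra h0
    have := hmax (2 * (c₁ + 1) + (c₂ - 1)) ⟨c₁ + 1, c₂ - 1, c₃, ρ.E12 v, ⟨h0, ?_, ?_, ?_⟩, rfl⟩
    · simp at this
      linarith
    · rw [brk_eq_iff.1 hρ.wt11_12, hv.E11, map_smul]
      module
    · rw [brk_eq_iff.1 hρ.wt22_12, hv.E22, map_smul, LinearMap.neg_apply]
      module
    · rw [brk_eq_iff.1 hρ.wt33_12, hv.E33, map_smul, LinearMap.zero_apply]
      module
  · by_contra h0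
    have := hmax (2 * c₁ + (c₂ + 1)) ⟨c₁, c₂ + 1, c₃ - 1, ρ.E23 v, ⟨h0, ?_, ?_, ?_⟩, rfl⟩
    · simp at this
      linarith
    · rw [brk_eq_iff.1 hρ.wt11_23, hv.E11, map_smul, LinearMap.zero_apply]
      module
    · rw [brk_eq_iff.1 hρ.wt22_23, hv.E22, map_smul]
      module
    · rw [brk_eq_iff.1 hρ.wt33_23, hv.E33, map_smul, LinearMap.neg_apply]
      module

/-- The vectors obtained from a highest weight vector by lowering with `E₂₁`. -/
theorem Ops.IsRep.lowering (hq : Generic h) (hρ : ρ.IsRep h) {c₁ c₂ c₃ : ℂ} {v : V}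
    (hv : IsWeightVector ρ c₁ c₂ c₃ v) (h12 : ρ.E12 v = 0) (h23 : ρ.E23 v = 0) (i : ℕ) :
    ρ.E11 ((ρ.E21 ^ i) v) = (c₁ - i) • (ρ.E21 ^ i) v ∧
    ρ.E22 ((ρ.E21 ^ i) v) = (c₂ + i) • (ρ.E21 ^ i) v ∧
    ρ.E33 ((ρ.E21 ^ i) v) = c₃ • (ρ.E21 ^ i) v ∧
    ρ.E23 ((ρ.E21 ^ i) v) = 0 ∧
    ρ.E12 ((ρ.E21 ^ (i + 1)) v) =
      (qn h (i + 1) * qn h (c₁ - c₂ - i)) • (ρ.E21 ^ i) v := by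
  have key : ∀ w, ρ.E12 (ρ.E21 w) = qnOp h ρ.H1 w + ρ.E21 (ρ.E12 w) := fun w => by
    rw [brk_eq_iff.1 hρ.comm12_21, one_smul]
  have hH : ∀ w : V, ∀ i : ℕ, ρ.E11 w = (c₁ - i) • w → ρ.E22 w = (c₂ + i) • w →
      qnOp h ρ.H1 w = qn h (c₁ - c₂ - i - i) • w := fun w i e1 e2 => by
    refine qnOp_apply_of_eigen h ?_
    rw [Ops.H1, LinearMap.sub_apply, e1, e2]
    module
  induction i with
  | zero =>
    refine ⟨by simpa using hv.E11, by simpa using hv.E22, by simpa using hv.E33,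
      by simpa using h23, ?_⟩
    have := hH v 0 (by simpa using hv.E11) (by simpa using hv.E22)
    simp only [zero_add, pow_one, pow_zero, Module.End.one_apply, key, h12, map_zero, add_zero,
      this, Nat.cast_zero, sub_zero]
    simp [qn, div_self hq.denom_ne]
  | succ i ih =>
    obtain ⟨e1, e2, e3, e4, e5⟩ := ih
    have hs : (ρ.E21 ^ (i + 1)) v = ρ.E21 ((ρ.E21 ^ i) v) := by
      rw [pow_succ', Module.End.mul_apply]
    have f1 : ρ.E11 ((ρ.E21 ^ (i + 1)) v) = (c₁ - (i + 1 : ℕ)) • (ρ.E21 ^ (i + 1)) v := by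
      rw [hs, brk_eq_iff.1 hρ.wt11_21, e1, map_smul, LinearMap.neg_apply]
      push_cast
      module
    have f2 : ρ.E22 ((ρ.E21 ^ (i + 1)) v) = (c₂ + (i + 1 : ℕ)) • (ρ.E21 ^ (i + 1)) v := by
      rw [hs, brk_eq_iff.1 hρ.wt22_21, e2, map_smul]
      push_cast
      module
    refine ⟨f1, f2, ?_, ?_, ?_⟩
    · rw [hs, brk_eq_iff.1 hρ.wt33_21, e3, map_smul, LinearMap.zero_apply]
      module
    · rw [hs, brk_eq_iff.1 hρ.comm23_21, e4, map_zero, smul_zero, LinearMap.zero_apply, zero_add]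
    · have hs' : (ρ.E21 ^ (i + 1 + 1)) v = ρ.E21 ((ρ.E21 ^ (i + 1)) v) := by
        rw [pow_succ', Module.End.mul_apply]
      rw [hs', key, e5, map_smul, ← hs, hH _ _ f1 f2, ← add_smul]
      congr 1
      -- With `p = i + 1` and `r = c₁ - c₂ - (i + 1)` the recursion is `[p + 1] [r] = [p] [r + 1] +
      -- [r - p]`.
      have := qn_succ_mul_sub hq (i + 1 : ℂ) (c₁ - c₂ - (i + 1 : ℂ))
      push_cast
      rw [← this]
      ring_nf

theorem Ops.IsRep.exists_lowering_eq_zero (hq : Generic h) (hρ : ρ.IsRep h) {c₁ c₂ c₃ : ℂ}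
    {v : V} (hv : IsWeightVector ρ c₁ c₂ c₃ v) (h12 : ρ.E12 v = 0) (h23 : ρ.E23 v = 0) :
    ∃ i, (ρ.E21 ^ i) v = 0 := by
  by_contra hne
  push Not at hne
  refine Set.infinite_of_injective_forall_mem (f := fun i : ℕ => c₁ - i) ?_ (fun i => ?_)
    (Module.End.finite_hasEigenvalue ρ.E11)
  · intro i j hij
    simpa using hij
  · exact Module.End.hasEigenvalue_of_hasEigenvector (x := (ρ.E21 ^ i) v)
      ⟨Module.End.mem_eigenspace_iff.2 (hρ.lowering hq hv h12 h23 i).1, hne i⟩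

/-- The highest weight of an even highest weight vector is a signature. -/
theorem Ops.IsRep.exists_signature (hq : Generic h) (hρ : ρ.IsRep h)
    (hreg : ρ.RegularWeights h) {c₁ c₂ c₃ : ℂ}
    {v : V} (hv : IsWeightVector ρ c₁ c₂ c₃ v) (h12 : ρ.E12 v = 0) (h23 : ρ.E23 v = 0) :
    ∃ S : Signature, S.m13 = c₁ ∧ S.m23 = c₂ ∧ S.m33 = c₃ ∧ (ρ.E21 ^ (S.n + 1)) v = 0 := by
  classical
  have hex := hρ.exists_lowering_eq_zero hq hv h12 h23
  obtain ⟨n, hn⟩ : ∃ n, Nat.find hex = n + 1 := Nat.exists_eq_succ_of_ne_zero fun e => by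
    have := Nat.find_spec hex
    rw [e] at this
    exact hv.ne_zero (by simpa using this)
  have h1 : (ρ.E21 ^ (n + 1)) v = 0 := hn ▸ Nat.find_spec hex
  have h2 : (ρ.E21 ^ n) v ≠ 0 := Nat.find_min hex (by omega)
  -- With `n + 1` the least vanishing power, `E₁₂` applied to `E₂₁ ^ (n + 1) v = 0` yields `[n + 1]
  -- [c₁ - c₂ - n] = 0`. Only regularity allows the conclusion `c₁ - c₂ = n`.
  have h3 := (hρ.lowering hq hv h12 h23 n).2.2.2.2
  rw [h1, map_zero, eq_comm, smul_eq_zero, or_iff_left h2, mul_eq_zero, or_iff_right] at h3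
  · have hc : ρ.H1.HasEigenvalue (c₁ - c₂) :=
      Module.End.hasEigenvalue_of_hasEigenvector (x := v)
        ⟨Module.End.mem_eigenspace_iff.2 (by
          rw [Ops.H1, LinearMap.sub_apply, hv.E11, hv.E22, sub_smul]), hv.ne_zero⟩
    have := hreg _ hc n (by exact_mod_cast h3)
    exact ⟨⟨c₁, c₂, c₃, n, by rw [← sub_eq_zero]; exact_mod_cast this⟩, rfl, rfl, rfl, h1⟩
  · exact_mod_cast qn_nat_ne hq n.succ_ne_zero

end HighestWeight

namespace Signature

variable (S : Signature) {h a₁ a₂ a₃ : ℂ}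

theorem Vq_E12_zero : (S.Vq h).E12 (S.vvec 0) = 0 := by
  rw [Vq, S.vOp_vvec _ (Nat.zero_le _)]
  simp [c12, m11]

theorem Vq_E12_succ {i : ℕ} (hi : i + 1 ≤ S.n) : (S.Vq h).E12 (S.vvec (i + 1)) =
    (rr h (i + 1) * S.ss h (i + 1)) • S.vvec i := by
  rw [Vq, S.vOp_vvec _ hi, c12, rr, ss, Nat.add_sub_cancel, m11, m13_eq]
  congr 3 <;> push_cast <;> ring

theorem Vq_E21 {i : ℕ} (hi : i ≤ S.n) : (S.Vq h).E21 (S.vvec i) =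
    (rr h (i + 1) * S.ss h (i + 1)) • S.vvec (i + 1) := by
  rw [Vq, S.vOp_vvec _ hi, c21, rr, ss, m11, m13_eq]
  congr 3 <;> push_cast <;> ring

/-- A highest weight vector of weight `[m]` in a representation generates an image of
`V^q([m])`. -/
theorem exists_even_map (hq : Generic h) {V : Type*} [AddCommGroup V] [Module ℂ V]
    [FiniteDimensional ℂ V] {ρ : Ops V} (hρ : ρ.IsRep h) {v : V}
    (hv : IsWeightVector ρ S.m13 S.m23 S.m33 v) (h12 : ρ.E12 v = 0) (h23 : ρ.E23 v = 0)
    (hn : (ρ.E21 ^ (S.n + 1)) v = 0) :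
    ∃ f : S.VSpace →ₗ[ℂ] V, EvenIntertwines (S.Vq h) ρ.toEvenOps f ∧
      (∀ x, ρ.E23 (f x) = 0) ∧ f (S.vvec 0) = v := by
  -- These scalars rescale `E₂₁ ^ i v` so that `E₂₁` acquires the Gelfand–Zetlin matrix elements.
  let κ : ℕ → ℂ := fun i => ∏ j ∈ Finset.range i, (rr h (j + 1) * S.ss h (j + 1))⁻¹
  let f : S.VSpace →ₗ[ℂ] V := S.vOp fun i => κ i • (ρ.E21 ^ i) v
  have hf : ∀ i ≤ S.n, f (S.vvec i) = κ i • (ρ.E21 ^ i) v := fun i hi => S.vOp_vvec _ hi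
  have hκ : ∀ i, i + 1 ≤ S.n → κ (i + 1) * (rr h (i + 1) * S.ss h (i + 1)) = κ i := by
    intro i hi
    have : rr h (i + 1) * S.ss h (i + 1) ≠ 0 := mul_ne_zero (rr_ne h hq (by omega))
      (S.ss_ne h hq hi)
    simp only [κ, Finset.prod_range_succ]
    rw [mul_assoc, inv_mul_cancel₀ this, mul_one]
  have hl := hρ.lowering hq hv h12 h23
  refine ⟨f, ⟨S.sem_of_vvec fun i hi => ?_, S.sem_of_vvec fun i hi => ?_,
    S.sem_of_vvec fun i hi => ?_, S.sem_of_vvec fun i hi => ?_,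
    S.sem_of_vvec fun i hi => ?_⟩, ?_, ?_⟩
  · rw [Vq, S.vOp_vvec _ hi, map_smul, hf i hi, map_smul, (hl i).1, m11, smul_comm]
  · rw [Vq, S.vOp_vvec _ hi, map_smul, hf i hi, map_smul, (hl i).2.1, m11, smul_comm]
    congr 2
    ring
  · rw [Vq, S.vOp_vvec _ hi, map_smul, hf i hi, map_smul, (hl i).2.2.1, smul_comm]
  · rcases i with _ | i
    · rw [Vq_E12_zero, map_zero, hf 0 hi, map_smul, pow_zero, Module.End.one_apply, h12, smul_zero]
    · rw [S.Vq_E12_succ hi, map_smul, hf i (by omega), hf _ hi, map_smul, (hl i).2.2.2.2,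
        smul_smul, smul_smul, ← hκ i hi]
      congr 1
      have e1 := rr_sq h (i + 1)
      have e2 := S.ss_sq h (i + 1)
      have e3 : (S.n : ℂ) + 1 - (i + 1 : ℕ) = S.m13 - S.m23 - i := by
        rw [S.sub_eq]
        push_cast
        ring
      rw [e3] at e2
      push_cast at e1
      rw [← e1, ← e2]
      ring
  · rw [S.Vq_E21 hi, map_smul, hf i hi, map_smul, ← Module.End.mul_apply, ← pow_succ']
    by_cases hi' : i + 1 ≤ S.n
    · rw [hf _ hi', smul_smul, ← hκ i hi', mul_comm]
    -- At the lowest vector the Gelfand–Zetlin target does not exist, which matches `E₂₁ ^ (n + 1) v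
    -- = 0`.
    · obtain rfl : i = S.n := by omega
      rw [S.vvec_eq_zero (by omega), map_zero, hn, smul_zero, smul_zero]
  · have : ρ.E23 ∘ₗ f = 0 := S.v_ext fun i hi => by
      rw [LinearMap.comp_apply, hf i hi, map_smul, (hl i).2.2.2.1, smul_zero,
        LinearMap.zero_apply]
    exact fun x => LinearMap.congr_fun this x
  · rw [hf 0 (Nat.zero_le _)]
    simp [κ]

/-- If both vanished, interpolation would give `[x] = [x + 1] = 0` for `x = m₂₃ + m₃₃`, and the
addition formula `[x + 1]² - [x] [x + 2] = [1]` would give `[1] = 0`. -/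
theorem xi_or_eta_ne (hq : Generic h) : S.xi h ≠ 0 ∨ S.eta h ≠ 0 := by
  by_contra hne
  push Not at hne
  have key : ∀ i : ℕ, qn h (S.m23 + S.m33 + i) = 0 := fun i => by
    have := S.rr_ss_interpolate hq i
    rw [hne.1, hne.2, mul_zero, mul_zero, add_zero, eq_comm, mul_eq_zero] at this
    exact this.resolve_left (S.qn_succ_ne h hq)
  have h0 := key 0
  have h1 := key 1
  simp only [Nat.cast_zero, add_zero, Nat.cast_one] at h0 h1
  have := qn_succ_mul_sub hq (S.m23 + S.m33) (S.m23 + S.m33 + 1)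
  rw [h1, h0, mul_zero, zero_mul, sub_zero, add_sub_cancel_left] at this
  exact qn_int_ne hq one_ne_zero (by exact_mod_cast this.symm)

end Signature

/-! ### Classification of the regular irreducible representations -/

theorem irreducible_iff (h : ℂ) (hq : Generic h)
    (a₁ a₂ a₃ : ℂ) (ha₁ : a₁ ≠ 0) (ha₂ : a₂ ≠ 0) (ha₃ : a₃ ≠ 0) {V : Type*} [AddCommGroup V]
    [Module ℂ V] [FiniteDimensional ℂ V] (ρ : Ops V) :
    (ρ.IsRep h ∧ ρ.Irreducible ∧ ρ.RegularWeights h) ↔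
      ∃ S : Signature,
        (S.Typical h ∧ Iso ρ (S.Wq h a₁ a₂ a₃)) ∨
        (S.Class1 h ∧ ∃ hI : (S.Wq h a₁ a₂ a₃).Invariant S.I1,
          Iso ρ ((S.Wq h a₁ a₂ a₃).quot S.I1 hI)) ∨
        (S.Class2 h ∧ ∃ hI : (S.Wq h a₁ a₂ a₃).Invariant S.I2,
          Iso ρ ((S.Wq h a₁ a₂ a₃).quot S.I2 hI)) := by
  constructor
  · rintro ⟨hρ, hirr, hreg⟩
    have := hirr.1
    obtain ⟨c₁, c₂, c₃, v, hv, h12, h23⟩ := hρ.exists_highest_weight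
    obtain ⟨S, rfl, rfl, rfl, hn⟩ := hρ.exists_signature hq hreg hv h12 h23
    obtain ⟨f, hf, hf0, hfv⟩ := S.exists_even_map hq hρ hv h12 h23 hn
    obtain ⟨g, hg, hgf⟩ := S.exists_extension hq ha₁ ha₂ ha₃ hρ hf hf0
    have hg0 : g ≠ 0 := by
      rintro rfl
      rw [← hgf] at hfv
      exact hv.ne_zero hfv.symm
    have hs := hirr.surjective hg hg0
    refine ⟨S, ?_⟩
    by_cases hxi : S.xi h = 0
    · have hS : S.Class2 h := ⟨(S.xi_or_eta_ne hq).resolve_left (not_not.2 hxi), hxi⟩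
      have hL := S.isLargest_I2 hq ha₁ ha₂ ha₃ hS
      exact Or.inr (Or.inr ⟨hS, hL.invariant,
        iso_quot_of_surjective hg hs _ (hL.ker_eq hirr hg hg0)⟩)
    · by_cases heta : S.eta h = 0
      · have hS : S.Class1 h := ⟨heta, hxi⟩
        have hL := S.isLargest_I1 hq ha₁ ha₂ ha₃ hS
        exact Or.inr (Or.inl ⟨hS, hL.invariant,
          iso_quot_of_surjective hg hs _ (hL.ker_eq hirr hg hg0)⟩)
      · have hS : S.Typical h := mul_ne_zero heta hxi
        have hL := S.isLargest_bot hq ha₁ ha₂ ha₃ hS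
        exact Or.inl ⟨hS, iso_of_surjective hg hs (hL.ker_eq hirr hg hg0)⟩
  · rintro ⟨S, hS⟩
    have main : ∀ {I : Submodule ℂ S.WSpace}, IsLargest (S.Wq h a₁ a₂ a₃) I →
        (∃ g : S.WSpace →ₗ[ℂ] V, Intertwines (S.Wq h a₁ a₂ a₃) ρ g ∧ Function.Surjective g ∧
          LinearMap.ker g = I) → ρ.IsRep h ∧ ρ.Irreducible ∧ ρ.RegularWeights h := by
      rintro I hI ⟨g, hg, hs, hk⟩
      exact ⟨IsRep.of_surjective (S.Wq_isRep hq ha₁ ha₂ ha₃) hg hs, hI.irreducible hg hs hk,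
        S.regularWeights hq hg hs⟩
    rcases hS with ⟨hS, hiso⟩ | ⟨hS, hI, hiso⟩ | ⟨hS, hI, hiso⟩
    · exact main (S.isLargest_bot hq ha₁ ha₂ ha₃ hS) hiso.exists_surjective
    · exact main (S.isLargest_I1 hq ha₁ ha₂ ha₃ hS) hiso.exists_surjective_of_quot
    · exact main (S.isLargest_I2 hq ha₁ ha₂ ha₃ hS) hiso.exists_surjective_of_quot

end UqGL21

theorem proposition8 (h : ℂ) (hq : UqGL21.Generic h)
    (a₁ a₂ a₃ : ℂ) (ha₁ : a₁ ≠ 0) (ha₂ : a₂ ≠ 0) (ha₃ : a₃ ≠ 0) :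
    (∀ S : UqGL21.Signature,
      (S.Wq h a₁ a₂ a₃).IsRep h ∧
      UqGL21.IsInduced.{u} h (S.Vq h) (S.Wq h a₁ a₂ a₃) S.incl) ∧
    ∀ (V : Type u) [AddCommGroup V] [Module ℂ V] [FiniteDimensional ℂ V] (ρ : UqGL21.Ops V),
      (ρ.IsRep h ∧ ρ.Irreducible ∧ ρ.RegularWeights h) ↔
      ∃ S : UqGL21.Signature,
        (S.Typical h ∧ UqGL21.Iso ρ (S.Wq h a₁ a₂ a₃)) ∨
        (S.Class1 h ∧ ∃ hI : (S.Wq h a₁ a₂ a₃).Invariant S.I1,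
          UqGL21.Iso ρ ((S.Wq h a₁ a₂ a₃).quot S.I1 hI)) ∨
        (S.Class2 h ∧ ∃ hI : (S.Wq h a₁ a₂ a₃).Invariant S.I2,
          UqGL21.Iso ρ ((S.Wq h a₁ a₂ a₃).quot S.I2 hI)) :=
  ⟨fun S => ⟨S.Wq_isRep hq ha₁ ha₂ ha₃, S.isInduced hq ha₁ ha₂ ha₃⟩,
    fun _ _ _ _ ρ => UqGL21.irreducible_iff h hq a₁ a₂ a₃ ha₁ ha₂ ha₃ ρ⟩
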